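/- Let $m\ge 1$, $h>0$, $R=\pi/h$. Let $\mathbf C^{(m)}$ be the complex Clifford algebra with generators $\mathbf e_1,\dots,\mathbf e_m$, $\mathbf e_j\mathbf e_k+\mathbf e_k\mathbf e_j=-2\delta_{jk}$, basis $\mathbf e_T=\mathbf e_{j_1}\cdots\mathbf e_{j_l}$ ($T=\{j_1<\dots<j_l\}$), scalar part $\mathrm{Sc}(\sum_T x_T\mathbf e_T)=x_\emptyset$, conjugation $\overline{\sum_T x_T\mathbf e_T}=\sum_T\overline{x_T}\,\overline{\mathbf e_{j_l}}\cdots\overline{\mathbf e_{j_1}}$ with $\overline{\mathbf e_j}=-\mathbf e_j$, and norm $|x|=(\sum_T|x_T|^2)^{1/2}$. Write para-vectors as $x=x_0+\underline x\in\mathbf R^{m+1}$ ($x_0\in\mathbf R$, $\underline x\in\mathbf R^m$), so that $\overline x=x_0-\underline x$, and put, for $\underline\xi\in\mathbf R^m$, $$e(x,\underline\xi)=e^{i\langle\underline x,\underline\xi\rangle}\Big(e^{-x_0|\underline\xi|}\,\tfrac12\big(1+i\tfrac{\underline\xi}{|\underline\xi|}\big)+e^{x_0|\underline\xi|}\,\tfrac12\big(1-i\tfrac{\underline\xi}{|\underline\xi|}\big)\Big).$$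 Let $\mathcal F$ be the Fourier transform on $L^2(\mathbf R^m,\mathbf C^{(m)})$, normalized by $\mathcal F(f)(\underline\xi)=\int_{\mathbf R^m}e^{-i\langle\underline x,\underline\xi\rangle}f(\underline x)\,d\underline x$ for $f\in L^1\cap L^2$. The Paley–Wiener space $PW(R,\mathbf C^{(m)})$ consists of the $f\in L^2(\mathbf R^m,\mathbf C^{(m)})$ with $\operatorname{supp}\mathcal F(f)\subset B(0,R)$; it carries the Clifford-valued inner product $\langle f,g\rangle=\int_{\mathbf R^m}\overline{g(\underline y)}f(\underline y)\,d\underline y$ and the norm $\|f\|^2=\mathrm{Sc}\,\langle f,f\rangle$. Then $PW(R,\mathbf C^{(m)})$ is a reproducing kernel Hilbert space of left-monogenic functions on $\mathbf R^{m+1}$, with kernel $$P(w,\overline x)=\frac1{(2\pi)^m}\int_{\mathbf R^m}e(w+\overline x,\underline\xi)\,\chi_{B(0,R)}(\underline\xi)\,d\underline\xi .$$ Explicitly: 1. $PW(R,\mathbf C^{(m)})$ is a right $\mathbf C^{(m)}$-module; $\langle f,g\rangle$ is given by a convergent integral, is right $\mathbf C^{(m)}$-linear in $f$, satisfies $\langle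 g,f\rangle=\overline{\langle f,g\rangle}$, and $\mathrm{Sc}\langle f,g\rangle$ is the complex Hilbert space inner product of $L^2$, so that $\|\cdot\|$ is the $L^2$ norm; and the space is complete. 2. Every $f\in PW(R,\mathbf C^{(m)})$ has a unique left-monogenic extension to $\mathbf R^{m+1}$, again denoted by $f$, that satisfies $|f(x)|\le Ce^{R|x|}$ for some constant $C$ and all $x\in\mathbf R^{m+1}$ (left-monogenic: $C^1$ with $\partial_0f+\sum_{j=1}^m\mathbf e_j\partial_jf=0$). For each $x\in\mathbf R^{m+1}$ the evaluation $f\mapsto f(x)$ is continuous on $PW(R,\mathbf C^{(m)})$. 3. The integral that defines $P(w,\overline x)$ converges for all $w,x\in\mathbf R^{m+1}$. For every $x\in\mathbf R^{m+1}$ the function $P(\cdot,\overline x)$ belongs to $PW(R,\mathbf C^{(m)})$ (its extension to $\mathbf R^{m+1}$ being $w\mapsto P(w,\overline x)$), and for all $f\in PW(R,\mathbf C^{(m)})$ $$\langle f,P(\cdot,\overline x)\rangle=\int_{\mathbf R^m}P(x,\overline{\underline y})f(\underline y)\,d\underline y=\frac1{(2\pi)^m}\int_{\mathbf R^m}e(x,\underline\xi)\,\chi_{B(0,R)}(\underline\xi)\,\mathcal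 F(f)(\underline\xi)\,d\underline\xi=f(x).$$ 4. $P$ is the only such kernel: if $q\in PW(R,\mathbf C^{(m)})$ and $\langle f,q\rangle=f(x)$ for all $f\in PW(R,\mathbf C^{(m)})$, then $q=P(\cdot,\overline x)$. For the complex Hilbert space structure, the operator-valued reproducing kernel at $(w,x)$ is left multiplication by $P(w,\overline x)$. -/

import Mathlib

open scoped symmDiff

noncomputable section

namespace CliffordPW

/-! ### The complex Clifford algebra with its basis, norm and conjugation -/

/-- The quadratic form `v ↦ -∑ j, v j ^ 2` on `ℂ^m`. -/
def clQ (m : ℕ) : QuadraticForm ℂ (Fin m → ℂ) :=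
  QuadraticMap.weightedSumSquares ℂ (fun _ : Fin m => (-1 : ℂ))

/-- The complex Clifford algebra `C^(m)`, with generators satisfying
`e_j e_k + e_k e_j = -2 δ_jk`. -/
def Cl (m : ℕ) : Type := CliffordAlgebra (clQ m)

instance (m : ℕ) : Ring (Cl m) := inferInstanceAs (Ring (CliffordAlgebra (clQ m)))
instance (m : ℕ) : Algebra ℂ (Cl m) := inferInstanceAs (Algebra ℂ (CliffordAlgebra (clQ m)))

variable {m : ℕ}

/-- The generator `e_j`. -/
def gen (j : Fin m) : Cl m := CliffordAlgebra.ι (clQ m) (Pi.single j 1)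

theorem gen_mul_self (j : Fin m) : gen j * gen j = -1 := by
  have := CliffordAlgebra.ι_sq_scalar (clQ m) (Pi.single j 1)
  have h2 : clQ m (Pi.single j 1) = -1 := by
    simp [clQ, QuadraticMap.weightedSumSquares_apply, Pi.single_apply]
  rw [h2, map_neg, map_one] at this
  exact this

theorem gen_anticomm {j k : Fin m} (h : j ≠ k) : gen j * gen k = -(gen k * gen j) := by
  have h1 := CliffordAlgebra.ι_mul_ι_add_swap (Q := clQ m) (Pi.single j 1) (Pi.single k 1)
  have h2 : QuadraticMap.polar (clQ m) (Pi.single j 1) (Pi.single k 1) = 0 := by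
    simp only [QuadraticMap.polar, clQ, QuadraticMap.weightedSumSquares_apply, ← Finset.sum_sub_distrib]
    refine Finset.sum_eq_zero fun i _ => ?_
    by_cases hj : i = j
    · subst hj; simp [h]
    · simp [Pi.single_apply, hj]
  rw [h2, map_zero] at h1
  exact eq_neg_of_add_eq_zero_left h1

/-- The ordered product `e_T = e_{j_1} ⋯ e_{j_l}` for `T = {j_1 < ⋯ < j_l}`. -/
def blade (T : Finset (Fin m)) : Cl m := ((T.sort (· ≤ ·)).map gen).prod

theorem blade_empty : blade (∅ : Finset (Fin m)) = 1 := by simp [blade]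

theorem blade_insert {j : Fin m} {T : Finset (Fin m)} (h : ∀ t ∈ T, j < t) :
    blade (insert j T) = gen j * blade T := by
  unfold blade
  rw [Finset.sort_insert (r := (· ≤ ·)) (fun b hb => (h b hb).le) (fun hj => lt_irrefl _ (h j hj))]
  simp

/-- The sign in `e_j e_T = ± e_{T ∆ {j}}`. -/
def sgn (j : Fin m) (T : Finset (Fin m)) : ℂ := ∏ i ∈ T, if i ≤ j then -1 else 1

theorem sgn_mul_self (j : Fin m) (T : Finset (Fin m)) : sgn j T * sgn j T = 1 := by
  unfold sgn
  rw [← Finset.prod_mul_distrib]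
  refine Finset.prod_eq_one fun i _ => ?_
  split_ifs <;> norm_num

theorem sgn_symmDiff (j k : Fin m) (T : Finset (Fin m)) :
    sgn j (T ∆ {k}) = sgn j T * (if k ≤ j then -1 else 1) := by
  by_cases h : k ∈ T
  · have h1 : T ∆ {k} = T.erase k := by
      ext i; simp only [Finset.mem_symmDiff, Finset.mem_singleton, Finset.mem_erase]
      by_cases hi : i = k <;> simp_all
    rw [h1]; unfold sgn
    rw [← Finset.mul_prod_erase T _ h]
    split_ifs <;> ring
  · have h1 : T ∆ {k} = insert k T := by
      ext i; simp only [Finset.mem_symmDiff, Finset.mem_singleton, Finset.mem_insert]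
      by_cases hi : i = k <;> simp_all
    rw [h1]; unfold sgn
    rw [Finset.prod_insert h]
    ring

theorem sgn_of_lt {j : Fin m} {T : Finset (Fin m)} (h : ∀ t ∈ T, j < t) : sgn j T = 1 :=
  Finset.prod_eq_one fun i hi => if_neg (h i hi).not_ge

theorem symmDiff_of_lt {j : Fin m} {T : Finset (Fin m)} (h : ∀ t ∈ T, j < t) :
    T ∆ {j} = insert j T := by
  have hj : j ∉ T := fun hj => lt_irrefl _ (h j hj)
  ext i; simp only [Finset.mem_symmDiff, Finset.mem_singleton, Finset.mem_insert]
  by_cases hi : i = j <;> simp_all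

theorem gen_mul_blade (j : Fin m) (T : Finset (Fin m)) :
    gen j * blade T = sgn j T • blade (T ∆ {j}) := by
  induction T using Finset.induction_on_min with
  | empty => rw [show (∅ : Finset (Fin m)) ∆ {j} = insert j ∅ by simp, blade_insert (by simp)]; simp [sgn]
  | insert a T ha ih =>
    have ha' : a ∉ T := fun h => lt_irrefl _ (ha a h)
    rcases lt_trichotomy j a with h | h | h
    · have hj : ∀ t ∈ insert a T, j < t := by
        intro t ht
        rcases Finset.mem_insert.1 ht with rfl | ht
        · exact h
        · exact h.trans (ha t ht)
      rw [sgn_of_lt hj, symmDiff_of_lt hj, blade_insert hj, one_smul]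
    · subst h
      have h1 : (insert j T) ∆ {j} = T := by
        rw [← symmDiff_of_lt ha, symmDiff_symmDiff_cancel_right]
      rw [h1, blade_insert ha, ← mul_assoc, gen_mul_self, ← symmDiff_of_lt ha, sgn_symmDiff,
        sgn_of_lt ha]
      simp
    · have h1 : (insert a T) ∆ {j} = insert a (T ∆ {j}) := by
        ext i; simp only [Finset.mem_symmDiff, Finset.mem_singleton, Finset.mem_insert]
        by_cases hi : i = j
        · subst hi; simp [h.ne']
        · simp [hi]
      have h2 : ∀ t ∈ T ∆ {j}, a < t := by
        intro t ht
        rcases Finset.mem_symmDiff.1 ht with h3 | h3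
        · exact ha t h3.1
        · rw [Finset.mem_singleton.1 h3.1]; exact h
      rw [h1, blade_insert ha, blade_insert h2, ← mul_assoc, gen_anticomm h.ne', neg_mul, mul_assoc,
        ih, mul_smul_comm, ← neg_smul]
      congr 1
      rw [← symmDiff_of_lt ha, sgn_symmDiff, if_pos h.le]; ring

/-- Left multiplication by `e_j` written in coordinates; it serves only to prove that the
`e_T` are linearly independent. -/
def leftOp (j : Fin m) : Module.End ℂ (Finset (Fin m) → ℂ) where
  toFun v T := sgn j (T ∆ {j}) * v (T ∆ {j})
  map_add' v w := by ext T; simp [mul_add]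
  map_smul' c v := by ext T; simp [mul_left_comm]

theorem leftOp_anticomm (j k : Fin m) (v : Finset (Fin m) → ℂ) (T : Finset (Fin m)) :
    leftOp j (leftOp k v) T + leftOp k (leftOp j v) T = if j = k then -2 * v T else 0 := by
  change sgn j (T ∆ {j}) * (sgn k ((T ∆ {j}) ∆ {k}) * v ((T ∆ {j}) ∆ {k})) +
    sgn k (T ∆ {k}) * (sgn j ((T ∆ {k}) ∆ {j}) * v ((T ∆ {k}) ∆ {j})) = _
  rw [symmDiff_right_comm T {k} {j}]
  simp only [sgn_symmDiff, le_refl, if_true]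
  rcases lt_trichotomy j k with h | h | h
  · rw [if_pos h.le, if_neg h.not_ge, if_neg h.ne]; ring
  · subst h
    simp only [le_refl, if_true, symmDiff_symmDiff_cancel_right]
    linear_combination (-2 * v T) * sgn_mul_self j T
  · rw [if_pos h.le, if_neg h.not_ge, if_neg h.ne']; ring

theorem leftOp_sq (v : Fin m → ℂ) :
    Fintype.linearCombination ℂ leftOp v * Fintype.linearCombination ℂ leftOp v =
      algebraMap ℂ (Module.End ℂ (Finset (Fin m) → ℂ)) (clQ m v) := by
  refine LinearMap.ext fun w => funext fun T => ?_
  have h1 : (Fintype.linearCombination ℂ leftOp v * Fintype.linearCombination ℂ leftOp v) w T =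
      ∑ j, ∑ k, v j * v k * leftOp j (leftOp k w) T := by
    simp only [Fintype.linearCombination_apply, Module.End.mul_apply, LinearMap.sum_apply,
      LinearMap.smul_apply, Finset.sum_apply, Pi.smul_apply, map_smul, smul_eq_mul,
      Finset.mul_sum]
    refine Finset.sum_comm.trans ?_
    refine Finset.sum_congr rfl fun j _ => Finset.sum_congr rfl fun k _ => by ring
  have h2 : ∑ j, ∑ k, v j * v k * leftOp j (leftOp k w) T =
      ∑ j, ∑ k, v j * v k * leftOp k (leftOp j w) T := by
    refine Finset.sum_comm.trans ?_
    refine Finset.sum_congr rfl fun j _ => Finset.sum_congr rfl fun k _ => by rw [mul_comm (v j)]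
  have h3 : ∑ j, ∑ k, v j * v k * leftOp j (leftOp k w) T +
      ∑ j, ∑ k, v j * v k * leftOp k (leftOp j w) T = ∑ j, v j * v j * (-2 * w T) := by
    rw [← Finset.sum_add_distrib]
    refine Finset.sum_congr rfl fun j _ => ?_
    rw [← Finset.sum_add_distrib]
    simp only [← mul_add, leftOp_anticomm]
    simp
  rw [h1]
  have h4 : (algebraMap ℂ (Module.End ℂ (Finset (Fin m) → ℂ)) (clQ m v)) w T =
      -(∑ j, v j * v j) * w T := by
    simp [clQ, QuadraticMap.weightedSumSquares_apply, Module.algebraMap_end_apply, Finset.sum_mul, mul_assoc]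
  rw [h4]
  rw [← h2, ← Finset.sum_mul] at h3
  linear_combination h3 / 2

/-- The representation of `C^(m)` on coordinate vectors given by the operators `leftOp j`. -/
def leftRep (m : ℕ) : Cl m →ₐ[ℂ] Module.End ℂ (Finset (Fin m) → ℂ) :=
  CliffordAlgebra.lift (clQ m) ⟨Fintype.linearCombination ℂ leftOp, leftOp_sq⟩

theorem leftRep_gen (j : Fin m) : leftRep m (gen j) = leftOp j := by
  refine (CliffordAlgebra.lift_ι_apply (Q := clQ m) _ leftOp_sq _).trans ?_
  simp [Fintype.linearCombination_apply_single]

theorem leftRep_blade (T : Finset (Fin m)) :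
    leftRep m (blade T) (Pi.single ∅ 1) = Pi.single T 1 := by
  induction T using Finset.induction_on_min with
  | empty => simp [blade_empty]
  | insert a T ha ih =>
    rw [blade_insert ha, map_mul, Module.End.mul_apply, ih, leftRep_gen]
    funext S
    change sgn a (S ∆ {a}) * (Pi.single T (1 : ℂ) : Finset (Fin m) → ℂ) (S ∆ {a}) = _
    rw [← symmDiff_of_lt ha]
    by_cases h : S ∆ {a} = T
    · have h' : S = T ∆ {a} := by rw [← h, symmDiff_symmDiff_cancel_right]
      rw [h, ← h', sgn_of_lt ha]; simp
    · have h' : S ≠ T ∆ {a} := fun h' => h (by rw [h', symmDiff_symmDiff_cancel_right])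
      simp [h, h']

theorem blade_linearIndependent : LinearIndependent ℂ (blade : Finset (Fin m) → Cl m) := by
  let φ : Cl m →ₗ[ℂ] (Finset (Fin m) → ℂ) :=
    (LinearMap.applyₗ (Pi.single ∅ 1)).comp (leftRep m).toLinearMap
  refine LinearIndependent.of_comp φ ?_
  have : φ ∘ blade = fun T : Finset (Fin m) => Pi.single T (1 : ℂ) := funext leftRep_blade
  rw [this]
  exact Pi.linearIndependent_single_one _ _

theorem blade_span : ⊤ ≤ Submodule.span ℂ (Set.range (blade : Finset (Fin m) → Cl m)) := by
  rintro x -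
  have hgen : ∀ (j : Fin m) (y : Cl m), y ∈ Submodule.span ℂ (Set.range (blade (m := m))) →
      gen j * y ∈ Submodule.span ℂ (Set.range (blade (m := m))) := by
    intro j y hy
    induction hy using Submodule.span_induction with
    | mem y hy =>
      obtain ⟨T, rfl⟩ := hy
      rw [gen_mul_blade]
      exact Submodule.smul_mem _ _ (Submodule.subset_span ⟨_, rfl⟩)
    | zero => simp
    | add y z _ _ h1 h2 => rw [mul_add]; exact Submodule.add_mem _ h1 h2
    | smul c y _ h => rw [mul_smul_comm]; exact Submodule.smul_mem _ _ h
  have key : ∀ x : CliffordAlgebra (clQ m),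
      (show Cl m from x) ∈ Submodule.span ℂ (Set.range (blade (m := m))) := by
    intro x
    induction x using CliffordAlgebra.left_induction with
    | algebraMap r =>
      have : (algebraMap ℂ (Cl m) r) = r • blade ∅ := by
        rw [blade_empty, Algebra.algebraMap_eq_smul_one]
      exact this ▸ Submodule.smul_mem _ _ (Submodule.subset_span ⟨_, rfl⟩)
    | add x y hx hy => exact Submodule.add_mem _ hx hy
    | ι_mul x v hx =>
      have hv : CliffordAlgebra.ι (clQ m) v = (∑ j, v j • gen j : Cl m) := by
        have : v = ∑ j, v j • (Pi.single j 1 : Fin m → ℂ) := by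
          funext i; simp [Finset.sum_apply, Pi.single_apply]
        conv_lhs => rw [this, map_sum]
        simp only [map_smul]
        rfl
      have h2 : (∑ j, v j • gen j : Cl m) * (show Cl m from x) ∈
          Submodule.span ℂ (Set.range (blade (m := m))) := by
        rw [Finset.sum_mul]
        refine Submodule.sum_mem _ fun j _ => ?_
        rw [smul_mul_assoc]
        exact Submodule.smul_mem _ _ (hgen j _ hx)
      rw [← hv] at h2
      exact h2
  exact key x

/-- The basis `(e_T)` of `C^(m)`. -/
def bladeBasis (m : ℕ) : Module.Basis (Finset (Fin m)) ℂ (Cl m) :=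
  Module.Basis.mk blade_linearIndependent blade_span

/-- The coordinates `x ↦ (x_T)` with respect to the basis `(e_T)`. -/
def coords (m : ℕ) : Cl m ≃ₗ[ℂ] EuclideanSpace ℂ (Finset (Fin m)) :=
  (bladeBasis m).equivFun.trans (WithLp.linearEquiv 2 ℂ (Finset (Fin m) → ℂ)).symm

/-- The norm `|x| = (∑ T, |x_T|^2)^(1/2)`. -/
instance (m : ℕ) : NormedAddCommGroup (Cl m) :=
  NormedAddCommGroup.induced (Cl m) (EuclideanSpace ℂ (Finset (Fin m))) (coords m)
    (coords m).injective

/-- The Hermitian inner product `∑ T, conj (x_T) * y_T`, whose norm is `|x|`. -/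
instance (m : ℕ) : InnerProductSpace ℂ (Cl m) where
  norm_smul_le c x := by
    change ‖coords m (c • x)‖ ≤ ‖c‖ * ‖coords m x‖
    rw [map_smul, norm_smul]
  inner x y := inner ℂ (coords m x) (coords m y)
  norm_sq_eq_re_inner x := norm_sq_eq_re_inner (coords m x)
  conj_inner_symm x y := inner_conj_symm (coords m x) (coords m y)
  add_left x y z := by rw [map_add, inner_add_left]
  smul_left x y c := by rw [map_smul, inner_smul_left]

instance (m : ℕ) : FiniteDimensional ℂ (Cl m) := Module.Finite.of_basis (bladeBasis m)

instance (m : ℕ) : CompleteSpace (Cl m) := FiniteDimensional.complete ℂ (Cl m)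
/-- The scalar part `x_∅`. -/
def Sc (x : Cl m) : ℂ := coords m x ∅

/-- Mathlib's (complex linear) Clifford conjugation: the anti-automorphism with `e_j ↦ -e_j`. -/
def cstar (x : Cl m) : Cl m := (star (show CliffordAlgebra (clQ m) from x) : CliffordAlgebra (clQ m))

/-- The conjugation `∑ T, x_T e_T ↦ ∑ T, conj (x_T) conj (e_T)`, where
`conj (e_T) = conj (e_{j_l}) ⋯ conj (e_{j_1})` and `conj (e_j) = -e_j`. -/
def conj (x : Cl m) : Cl m :=
  ∑ T, starRingEnd ℂ (coords m x T) • cstar (blade T)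

/-! ### Para-vectors, monogenic functions and the exponential `e(x, ξ)` -/

/-- The space `R^m` of vectors. -/
abbrev V (m : ℕ) : Type := EuclideanSpace ℝ (Fin m)

/-- The space `R^(m+1)` of para-vectors `x = x_0 + x_`, with `x.fst = x_0` and `x.snd = x_`. -/
abbrev X (m : ℕ) : Type := WithLp 2 (ℝ × V m)

/-- The para-vector with scalar part `s` and vector part `v`. -/
def para (s : ℝ) (v : V m) : X m := WithLp.toLp 2 (s, v)

/-- The conjugate `x_0 - x_` of a para-vector. -/
def paraConj (x : X m) : X m := para x.fst (-x.snd)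

/-- The vector `ξ` as an element `∑ j, ξ_j e_j` of the Clifford algebra. -/
def vec (ξ : V m) : Cl m := ∑ j, (ξ j : ℂ) • gen j

/-- The Dirac operator `D = ∂_0 + ∑ j, e_j ∂_j` acting from the left. -/
def dirac (F : X m → Cl m) (x : X m) : Cl m :=
  fderiv ℝ F x (para 1 0) + ∑ j, gen j * fderiv ℝ F x (para 0 (EuclideanSpace.single j 1))

/-- `F` is left-monogenic on the whole of `R^(m+1)`. -/
def IsLeftMonogenic (F : X m → Cl m) : Prop :=
  ContDiff ℝ 1 F ∧ ∀ x, dirac F x = 0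

/-- `χ_+(ξ) = (1 + i ξ / |ξ|) / 2`. -/
def chiPlus (ξ : V m) : Cl m := (1 / 2 : ℂ) • (1 + (Complex.I / (‖ξ‖ : ℂ)) • vec ξ)

/-- `χ_-(ξ) = (1 - i ξ / |ξ|) / 2`. -/
def chiMinus (ξ : V m) : Cl m := (1 / 2 : ℂ) • (1 - (Complex.I / (‖ξ‖ : ℂ)) • vec ξ)

/-- `e^+(x, ξ) = exp (i ⟨x_, ξ⟩) exp (-x_0 |ξ|) χ_+(ξ)`. -/
def ePlus (x : X m) (ξ : V m) : Cl m :=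
  (Complex.exp (Complex.I * ((inner ℝ x.snd ξ : ℝ) : ℂ)) * Complex.exp (-((x.fst * ‖ξ‖ : ℝ) : ℂ))) •
    chiPlus ξ

/-- `e^-(x, ξ) = exp (i ⟨x_, ξ⟩) exp (x_0 |ξ|) χ_-(ξ)`. -/
def eMinus (x : X m) (ξ : V m) : Cl m :=
  (Complex.exp (Complex.I * ((inner ℝ x.snd ξ : ℝ) : ℂ)) * Complex.exp ((x.fst * ‖ξ‖ : ℝ) : ℂ)) •
    chiMinus ξ

/-- `e(x, ξ) = e^+(x, ξ) + e^-(x, ξ)`. -/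
def eFun (x : X m) (ξ : V m) : Cl m := ePlus x ξ + eMinus x ξ

/-- The kernel `P(w, z) = (2π)^(-m) ∫ e(w + z, ξ) χ_{B(0,R)}(ξ) dξ`. -/
def pwKernel (R : ℝ) (w z : X m) : Cl m :=
  (((2 * Real.pi) ^ m)⁻¹ : ℝ) • ∫ ξ : V m, (Metric.ball 0 R).indicator (eFun (w + z)) ξ

/-! ### The Paley–Wiener space -/

/-- The space `L^2(R^m, C^(m))`. -/
abbrev L2 (m : ℕ) : Type := MeasureTheory.Lp (Cl m) 2 (MeasureTheory.volume : MeasureTheory.Measure (V m))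

/-- The Fourier transform on `L^2(R^m, C^(m))` with the normalization
`∫ exp (-i ⟨x, ξ⟩) f(x) dx`; Mathlib's `𝓕` uses `exp (-2πi ⟨x, ξ⟩)`. -/
def fourierL2 (f : L2 m) (ξ : V m) : Cl m :=
  (FourierTransform.fourier f : L2 m) ((2 * Real.pi)⁻¹ • ξ)

theorem ae_smul {p : V m → Prop} (h : ∀ᵐ ξ, p ξ) : ∀ᵐ ξ : V m, p ((2 * Real.pi)⁻¹ • ξ) := by
  have hne : (2 * Real.pi)⁻¹ ≠ 0 := inv_ne_zero Real.two_pi_pos.ne'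
  have h1 : MeasureTheory.Measure.QuasiMeasurePreserving (fun ξ : V m => (2 * Real.pi)⁻¹ • ξ) := by
    refine ⟨measurable_const_smul _, ?_⟩
    rw [MeasureTheory.Measure.map_addHaar_smul _ hne]
    exact MeasureTheory.Measure.smul_absolutelyContinuous
  exact h1.ae h

theorem fourierL2_add (f g : L2 m) : fourierL2 (f + g) =ᵐ[MeasureTheory.volume] fourierL2 f + fourierL2 g := by
  have h : (FourierTransform.fourier (f + g) : L2 m) =
      FourierTransform.fourier f + FourierTransform.fourier g := FourierAdd.fourier_add f g
  have h2 := ae_smul (MeasureTheory.Lp.coeFn_add (FourierTransform.fourier f : L2 m)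
    (FourierTransform.fourier g))
  filter_upwards [h2] with ξ hξ
  simpa [fourierL2, h] using hξ

theorem fourierL2_smul (c : ℂ) (f : L2 m) : fourierL2 (c • f) =ᵐ[MeasureTheory.volume] c • fourierL2 f := by
  have h : (FourierTransform.fourier (c • f) : L2 m) = c • FourierTransform.fourier f :=
    FourierSMul.fourier_smul c f
  have h2 := ae_smul (MeasureTheory.Lp.coeFn_smul c (FourierTransform.fourier f : L2 m))
  filter_upwards [h2] with ξ hξ
  simpa [fourierL2, h] using hξ

/-- The Paley–Wiener space `PW(R, C^(m))`: the `f ∈ L^2(R^m, C^(m))` whose Fourier transform is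
supported in the ball `B(0, R)`. -/
def PW (m : ℕ) (R : ℝ) : Submodule ℂ (L2 m) where
  carrier := {f | ∀ᵐ ξ : V m, ξ ∉ Metric.closedBall (0 : V m) R → fourierL2 f ξ = 0}
  add_mem' := by
    intro f g hf hg
    filter_upwards [hf, hg, fourierL2_add f g] with ξ h1 h2 h3 h
    rw [h3, Pi.add_apply, h1 h, h2 h, add_zero]
  zero_mem' := by
    have h := fourierL2_smul (m := m) 0 0
    filter_upwards [h] with ξ h1 _
    simpa using h1
  smul_mem' := by
    intro c f hf
    filter_upwards [hf, fourierL2_smul c f] with ξ h1 h2 h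
    rw [h2, Pi.smul_apply, h1 h, smul_zero]

/-- The Clifford-valued inner product `⟨f, g⟩ = ∫ conj (g y) f(y) dy`. -/
def cInner (f g : L2 m) : Cl m := ∫ y, conj (g y) * f y

/-- The function `y ↦ f(y) a` for a Clifford number `a`. -/
def rmul (f : L2 m) (a : Cl m) : L2 m :=
  (LinearMap.toContinuousLinearMap (LinearMap.mulRight ℂ a)).compLp f

/-- `F` is the left-monogenic extension of `f` to `R^(m+1)`, of exponential type `R`: it is
left-monogenic on `R^(m+1)`, its restriction to `R^m` is `f`, and `|F(x)| ≤ C exp (R |x|)`. -/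
structure IsExtension (R : ℝ) (f : L2 m) (F : X m → Cl m) : Prop where
  monogenic : IsLeftMonogenic F
  restrict : (fun y : V m => F (para 0 y)) =ᵐ[MeasureTheory.volume] f
  bound : ∃ C : ℝ, ∀ x, ‖F x‖ ≤ C * Real.exp (R * ‖x‖)

end CliffordPW

end

open CliffordPW MeasureTheory

/-! ### Conjugation as adjoint; multiplication as a bounded bilinear map. -/

namespace CliffordPW

variable {m : ℕ}

/-! On the Fourier side everything is explicit. For `ξ ≠ 0` the elements `χ_±(ξ)` are complementary
self-adjoint idempotents on which `iξ` acts as `±|ξ|`. Three facts follow: the Dirac operator kills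
`e(·, ξ)`, `e(w + z, ξ) = e(w, ξ) e(z, ξ)` (`eFun_add`), and the conjugate of `e(x, ξ)` is `e(x̄,
ξ)` (`conj_eFun`). On `R^m`, `e(y, ξ)` is the plane wave `exp(i⟨y, ξ⟩)`. Hence the inversion formula
with `e(x, ξ)` in place of the plane wave, `pwExt`, extends `f` monogenically, and `|e(x, ξ)| ≤ C
exp(|ξ||x|)` gives the exponential type (`isExtension_pwExt`).

The kernel element is the function with Fourier transform `χ_B e(x̄, ·)`. Plancherel's theorem in
its Clifford-valued form (`cInner_eq_integral_fourierL2`) turns `⟨f, P(·, x̄)⟩` into the extension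
integral at `x` (`cInner_kernelElement`), and the product rule for `e` identifies the values of that
element with `P(w, x̄)` (`pwExt_kernelElement`). Continuity of evaluation, uniqueness of the kernel
and the operator-valued kernel are consequences of this identity. The bridge between Clifford and
Hilbert structure is `inner_mul_left`: left multiplication by `conj u` is the adjoint of left
multiplication by `u`.

The remaining point is that a monogenic function of exponential growth vanishing on `R^m` is zero
(`IsLeftMonogenic.eq_zero`). With `x_0` as time the equation reads `∂_t F = -A F`, `A = ∑ e_j ∂_j`.
Both `e_j` and `∂_j` are skew, so `A` is formally symmetric and `log ‖F(t)‖²` would be convex, which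
forbids isolated zeros in time. Growth in space calls for a weight `exp(-c√(1+|x|²))`; its
logarithmic gradient is bounded and perturbs the symmetry only by a bounded skew term. The convexity
survives as the family of inequalities in `eq_zero_of_second_order`. Since `F` is only `C^1`, the
argument is run on its mollifications in the space variable (`eq_zero_of_system`). -/

theorem coords_blade (T : Finset (Fin m)) :
    coords m (blade T) = EuclideanSpace.single T (1 : ℂ) := by
  have h : blade T = bladeBasis m T := (Module.Basis.mk_apply _ _ T).symm
  ext S
  rw [h]
  simp [coords, Finsupp.single_apply, eq_comm]

theorem sum_coords (a : Cl m) : ∑ T, coords m a T • blade T = a := by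
  have h : ∀ T : Finset (Fin m), blade T = bladeBasis m T :=
    fun T => (Module.Basis.mk_apply blade_linearIndependent blade_span T).symm
  simp_rw [h]
  exact (bladeBasis m).sum_equivFun a

theorem inner_def (a b : Cl m) : inner ℂ a b = inner ℂ (coords m a) (coords m b) := rfl

theorem coords_gen_mul (j : Fin m) (a : Cl m) (T : Finset (Fin m)) :
    coords m (gen j * a) T = sgn j (T ∆ {j}) * coords m a (T ∆ {j}) := by
  conv_lhs => rw [← sum_coords a]
  simp only [Finset.mul_sum, mul_smul_comm, gen_mul_blade, map_sum, map_smul, coords_blade]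
  simp only [WithLp.ofLp_sum, Finset.sum_apply, WithLp.ofLp_smul, Pi.smul_apply,
    PiLp.single_apply, smul_eq_mul]
  rw [Finset.sum_eq_single (T ∆ {j})]
  · rw [symmDiff_symmDiff_cancel_right]; simp [mul_comm]
  · intro S _ hS
    rw [if_neg, mul_zero, mul_zero]
    rintro rfl
    exact hS (by rw [symmDiff_symmDiff_cancel_right])
  · simp

theorem conj_sgn (j : Fin m) (T : Finset (Fin m)) : starRingEnd ℂ (sgn j T) = sgn j T := by
  unfold sgn
  rw [map_prod]
  refine Finset.prod_congr rfl fun i _ => ?_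
  split_ifs <;> simp

/-- In coordinates `e_j` acts by the involution `T ↦ T ∆ {j}` with signs, and the signs at `T` and
`T ∆ {j}` are opposite. This skewness is the source of all adjoint relations, and it is what the
uniqueness theorem uses. -/
theorem inner_gen_mul_left (j : Fin m) (a b : Cl m) :
    inner ℂ (gen j * a) b = -inner ℂ a (gen j * b) := by
  simp only [inner_def, PiLp.inner_apply, coords_gen_mul, RCLike.inner_apply, map_mul, conj_sgn]
  rw [← Finset.sum_neg_distrib]
  have hinv : Function.Involutive (fun T : Finset (Fin m) => T ∆ {j}) :=
    fun T => symmDiff_symmDiff_cancel_right _ _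
  refine Fintype.sum_equiv hinv.toPerm _ _ fun T => ?_
  simp only [Function.Involutive.coe_toPerm, symmDiff_symmDiff_cancel_right, sgn_symmDiff, le_refl,
    if_true]
  ring

theorem cstar_mul (a b : Cl m) : cstar (a * b) = cstar b * cstar a :=
  star_mul (R := CliffordAlgebra (clQ m)) a b

theorem cstar_one : cstar (1 : Cl m) = 1 := star_one (CliffordAlgebra (clQ m))

theorem cstar_gen (j : Fin m) : cstar (gen j) = -gen j := by
  change star (CliffordAlgebra.ι (clQ m) _) = -CliffordAlgebra.ι (clQ m) _
  rw [CliffordAlgebra.star_ι]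

theorem inner_blade_mul_left (T : Finset (Fin m)) (a b : Cl m) :
    inner ℂ (blade T * a) b = inner ℂ a (cstar (blade T) * b) := by
  induction T using Finset.induction_on_min generalizing a b with
  | empty => rw [blade_empty, cstar_one, one_mul, one_mul]
  | insert j T hj ih =>
    rw [blade_insert hj, mul_assoc, inner_gen_mul_left, ih, cstar_mul, cstar_gen, mul_assoc,
      neg_mul, mul_neg, inner_neg_right]

/-- Left multiplication by `conj u` is the adjoint of left multiplication by `u`. -/
theorem inner_mul_left (u a b : Cl m) : inner ℂ (u * a) b = inner ℂ a (conj u * b) := by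
  conv_lhs => rw [← sum_coords u]
  simp only [conj, Finset.sum_mul, sum_inner, inner_sum, smul_mul_assoc, inner_smul_left,
    inner_smul_right, inner_blade_mul_left]

theorem inner_one_left (a : Cl m) : inner ℂ 1 a = Sc a := by
  rw [inner_def, ← blade_empty, coords_blade, EuclideanSpace.inner_single_left]
  simp [Sc]

theorem Sc_conj_mul (a b : Cl m) : Sc (conj a * b) = inner ℂ a b := by
  rw [← inner_one_left, ← inner_mul_left, mul_one]

theorem conj_mul (a b : Cl m) : conj (a * b) = conj b * conj a := by
  refine ext_inner_left ℂ fun v => ?_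
  have := inner_mul_left (a * b) v 1
  rw [mul_one] at this
  rw [← this, mul_assoc, inner_mul_left, inner_mul_left, mul_one]

theorem conj_conj (a : Cl m) : conj (conj a) = a := by
  refine ext_inner_left ℂ fun v => ?_
  have h1 := inner_mul_left (conj a) v 1
  have h2 := inner_mul_left a 1 v
  rw [mul_one] at h1 h2
  rw [← h1, ← inner_conj_symm, ← h2, inner_conj_symm]

/-- Adjoints are unique, so identities for the conjugation reduce to identities for adjoints, with
no computation on blades. -/
theorem conj_eq_of_inner {a b : Cl m} (h : ∀ u v, inner ℂ (a * u) v = inner ℂ u (b * v)) :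
    conj a = b := by
  refine ext_inner_left ℂ fun v => ?_
  have := inner_mul_left a v 1
  rw [h, mul_one, mul_one] at this
  exact this.symm

theorem conj_add (a b : Cl m) : conj (a + b) = conj a + conj b := by
  refine conj_eq_of_inner fun u v => ?_
  rw [add_mul, add_mul, inner_add_left, inner_add_right, inner_mul_left, inner_mul_left]

theorem conj_smul (c : ℂ) (a : Cl m) : conj (c • a) = starRingEnd ℂ c • conj a := by
  refine conj_eq_of_inner fun u v => ?_
  rw [smul_mul_assoc, smul_mul_assoc, inner_smul_left, inner_smul_right, inner_mul_left]

theorem conj_one : conj (1 : Cl m) = 1 := conj_eq_of_inner fun u v => by simp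

theorem conj_real_smul (c : ℝ) (a : Cl m) : conj (c • a) = c • conj a := by
  rw [← Complex.coe_smul, conj_smul, Complex.conj_ofReal, Complex.coe_smul]

/-- The conjugation as a continuous real-linear map. -/
noncomputable def conjCLM (m : ℕ) : Cl m →L[ℝ] Cl m :=
  haveI : FiniteDimensional ℝ (Cl m) := FiniteDimensional.complexToReal (Cl m)
  LinearMap.toContinuousLinearMap
    { toFun := conj, map_add' := conj_add, map_smul' := conj_real_smul }

@[simp] theorem conjCLM_apply (a : Cl m) : conjCLM m a = conj a := rfl

/-- Multiplication as a continuous bilinear map. -/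
noncomputable def mulCLM (m : ℕ) : Cl m →L[ℂ] Cl m →L[ℂ] Cl m :=
  LinearMap.toContinuousLinearMap
    ((LinearMap.toContinuousLinearMap (𝕜 := ℂ) (E := Cl m) (F' := Cl m)).toLinearMap.comp
      (LinearMap.mul ℂ (Cl m)))

@[simp] theorem mulCLM_apply (a b : Cl m) : mulCLM m a b = a * b := rfl

/-- The norm is not submultiplicative: the idempotent `(1 + i e_1)/2` has norm `1/√2`. Hence the
constant `‖mulCLM m‖` in all estimates of products. -/
theorem norm_mul_le_mulCLM (a b : Cl m) : ‖a * b‖ ≤ ‖mulCLM m‖ * ‖a‖ * ‖b‖ :=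
  (mulCLM m).le_opNorm₂ a b

theorem continuous_mul_cl : Continuous fun p : Cl m × Cl m => p.1 * p.2 := by
  have : Continuous fun p : Cl m × Cl m => mulCLM m p.1 p.2 := by fun_prop
  exact this

theorem ext_Sc {a b : Cl m} (h : ∀ u, Sc (conj u * a) = Sc (conj u * b)) : a = b := by
  refine ext_inner_left ℂ fun v => ?_
  rw [← Sc_conj_mul, ← Sc_conj_mul, h]

/-! ### Vectors and the idempotents `χ_±` -/

theorem conj_vec (ξ : V m) : conj (vec ξ) = -vec ξ := by
  refine conj_eq_of_inner fun u v => ?_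
  simp only [vec, Finset.sum_mul, sum_inner, inner_sum, smul_mul_assoc, inner_smul_left,
    inner_gen_mul_left, neg_mul, inner_neg_right, inner_smul_right, Complex.conj_ofReal, mul_neg,
    Finset.sum_neg_distrib]

theorem vec_mul_vec (ξ : V m) : vec ξ * vec ξ = (-(‖ξ‖ ^ 2 : ℝ) : ℂ) • 1 := by
  have h1 : vec ξ = CliffordAlgebra.ι (clQ m) (fun j => (ξ j : ℂ)) := by
    have : (fun j => (ξ j : ℂ)) = ∑ j, (ξ j : ℂ) • (Pi.single j 1 : Fin m → ℂ) := by
      funext i; simp [Finset.sum_apply, Pi.single_apply]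
    rw [this, map_sum]
    simp only [map_smul]
    rfl
  have h2 := CliffordAlgebra.ι_sq_scalar (clQ m) (fun j => (ξ j : ℂ))
  have h3 : vec ξ * vec ξ = algebraMap ℂ (Cl m) (clQ m (fun j => (ξ j : ℂ))) := by
    rw [h1]; exact h2
  rw [h3, Algebra.algebraMap_eq_smul_one]
  congr 1
  rw [EuclideanSpace.norm_sq_eq]
  simp [clQ, QuadraticMap.weightedSumSquares_apply, sq]

theorem I_div_smul_vec_sq {ξ : V m} (hξ : ξ ≠ 0) :
    ((Complex.I / (‖ξ‖ : ℂ)) • vec ξ) * ((Complex.I / (‖ξ‖ : ℂ)) • vec ξ) = 1 := by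
  have h : (‖ξ‖ : ℂ) ≠ 0 := by simpa using hξ
  rw [smul_mul_smul_comm, vec_mul_vec, smul_smul]
  have : Complex.I / (‖ξ‖ : ℂ) * (Complex.I / (‖ξ‖ : ℂ)) * (-(‖ξ‖ ^ 2 : ℝ) : ℂ) = 1 := by
    push_cast
    field_simp
    simp
  rw [this, one_smul]

theorem conj_I_div_smul_vec (ξ : V m) :
    conj ((Complex.I / (‖ξ‖ : ℂ)) • vec ξ) = (Complex.I / (‖ξ‖ : ℂ)) • vec ξ := by
  rw [conj_smul, conj_vec, map_div₀, Complex.conj_I, Complex.conj_ofReal, neg_div, smul_neg,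
    neg_smul, neg_neg]

theorem conj_chiPlus (ξ : V m) : conj (chiPlus ξ) = chiPlus ξ := by
  rw [chiPlus, conj_smul, conj_add, conj_one, conj_I_div_smul_vec]
  simp [map_ofNat]

theorem chiMinus_eq (ξ : V m) : chiMinus ξ = 1 - chiPlus ξ := by
  rw [chiMinus, chiPlus]
  module

theorem conj_chiMinus (ξ : V m) : conj (chiMinus ξ) = chiMinus ξ := by
  rw [chiMinus_eq, sub_eq_add_neg, ← neg_one_smul ℂ, conj_add, conj_smul, conj_one, conj_chiPlus]
  simp

theorem chiPlus_mul_self {ξ : V m} (hξ : ξ ≠ 0) : chiPlus ξ * chiPlus ξ = chiPlus ξ := by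
  have h := I_div_smul_vec_sq hξ
  simp only [chiPlus]
  set q := (Complex.I / (‖ξ‖ : ℂ)) • vec ξ
  rw [smul_mul_smul_comm, mul_add, mul_one, add_mul, one_mul, h]
  module

theorem chiPlus_mul_chiMinus {ξ : V m} (hξ : ξ ≠ 0) : chiPlus ξ * chiMinus ξ = 0 := by
  rw [chiMinus_eq, mul_sub, mul_one, chiPlus_mul_self hξ, sub_self]

theorem chiMinus_mul_chiPlus {ξ : V m} (hξ : ξ ≠ 0) : chiMinus ξ * chiPlus ξ = 0 := by
  rw [chiMinus_eq, sub_mul, one_mul, chiPlus_mul_self hξ, sub_self]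

theorem chiMinus_mul_self {ξ : V m} (hξ : ξ ≠ 0) : chiMinus ξ * chiMinus ξ = chiMinus ξ := by
  conv_lhs => rw [chiMinus_eq, sub_mul, one_mul, ← chiMinus_eq, chiPlus_mul_chiMinus hξ, sub_zero]

theorem vec_zero : vec (0 : V m) = 0 := by simp [vec]

/-- `χ_+` projects onto the eigenspace of `iξ` for the eigenvalue `|ξ|`. At `ξ = 0` division by zero
makes `χ_+` equal to `1/2`, no idempotent, but both sides vanish. -/
theorem I_smul_vec_mul_chiPlus (ξ : V m) :
    Complex.I • (vec ξ * chiPlus ξ) = (‖ξ‖ : ℂ) • chiPlus ξ := by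
  rcases eq_or_ne ξ 0 with rfl | hξ
  · simp [vec_zero]
  have h : (‖ξ‖ : ℂ) ≠ 0 := by simpa using hξ
  have h1 : Complex.I • vec ξ = (‖ξ‖ : ℂ) • ((Complex.I / (‖ξ‖ : ℂ)) • vec ξ) := by
    rw [smul_smul, mul_div_cancel₀ _ h]
  have h2 := I_div_smul_vec_sq hξ
  rw [← smul_mul_assoc, h1, smul_mul_assoc]
  congr 1
  simp only [chiPlus]
  set q := (Complex.I / (‖ξ‖ : ℂ)) • vec ξ
  rw [mul_smul_comm, mul_add, mul_one, h2, add_comm]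

theorem I_smul_vec_mul_chiMinus (ξ : V m) :
    Complex.I • (vec ξ * chiMinus ξ) = -((‖ξ‖ : ℂ) • chiMinus ξ) := by
  rcases eq_or_ne ξ 0 with rfl | hξ
  · simp [vec_zero]
  have h : (‖ξ‖ : ℂ) ≠ 0 := by simpa using hξ
  have h1 : Complex.I • vec ξ = (‖ξ‖ : ℂ) • ((Complex.I / (‖ξ‖ : ℂ)) • vec ξ) := by
    rw [smul_smul, mul_div_cancel₀ _ h]
  have h2 := I_div_smul_vec_sq hξ
  rw [← smul_mul_assoc, h1, smul_mul_assoc, ← smul_neg]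
  congr 1
  simp only [chiMinus]
  set q := (Complex.I / (‖ξ‖ : ℂ)) • vec ξ
  rw [mul_smul_comm, mul_sub, mul_one, h2, ← smul_neg, neg_sub]

theorem norm_vec (ξ : V m) : ‖vec ξ‖ = ‖ξ‖ * ‖(1 : Cl m)‖ := by
  have h1 : ((‖vec ξ‖ ^ 2 : ℝ) : ℂ) = ((‖ξ‖ * ‖(1 : Cl m)‖) ^ 2 : ℝ) := by
    have h2 := inner_mul_left (vec ξ) 1 (vec ξ)
    rw [mul_one, conj_vec, neg_mul, vec_mul_vec, inner_neg_right, inner_smul_right,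
      inner_self_eq_norm_sq_to_K, inner_self_eq_norm_sq_to_K] at h2
    push_cast at h2 ⊢
    linear_combination h2
  have h2 := Complex.ofReal_injective h1
  exact (pow_left_inj₀ (norm_nonneg _) (by positivity) two_ne_zero).1 h2

theorem norm_I_div_smul_vec_le (ξ : V m) :
    ‖(Complex.I / (‖ξ‖ : ℂ)) • vec ξ‖ ≤ ‖(1 : Cl m)‖ := by
  rcases eq_or_ne ξ 0 with rfl | hξ
  · simp [vec_zero]
  · have : ‖ξ‖ ≠ 0 := by simpa using hξ
    rw [norm_smul, norm_vec, norm_div, Complex.norm_I, Complex.norm_real, norm_norm]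
    apply le_of_eq
    field_simp

theorem norm_chiPlus_le (ξ : V m) : ‖chiPlus ξ‖ ≤ ‖(1 : Cl m)‖ := by
  rw [chiPlus, norm_smul]
  have := (norm_add_le (1 : Cl m) ((Complex.I / (‖ξ‖ : ℂ)) • vec ξ)).trans
    (add_le_add_right (norm_I_div_smul_vec_le ξ) _)
  norm_num
  linarith

theorem norm_chiMinus_le (ξ : V m) : ‖chiMinus ξ‖ ≤ ‖(1 : Cl m)‖ := by
  rw [chiMinus, norm_smul]
  have := (norm_sub_le (1 : Cl m) ((Complex.I / (‖ξ‖ : ℂ)) • vec ξ)).trans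
    (add_le_add_right (norm_I_div_smul_vec_le ξ) _)
  norm_num
  linarith

end CliffordPW

/-! ### The `L²` inverse Fourier transform as an integral. -/

open FourierTransform SchwartzMap in
/-- The inverse Fourier transform on `L^2` of an integrable function is given by the integral. -/
theorem MeasureTheory.MemLp.fourierInv_toLp_ae {E F : Type*} [NormedAddCommGroup E]
    [InnerProductSpace ℝ E] [FiniteDimensional ℝ E] [MeasurableSpace E] [BorelSpace E]
    [NormedAddCommGroup F] [InnerProductSpace ℂ F] [CompleteSpace F] {h : E → F}
    (h2 : MemLp h 2 volume) (h1 : Integrable h volume) :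
    (𝓕⁻ (h2.toLp h) : Lp F 2 (volume : Measure E)) =ᵐ[volume] 𝓕⁻ h := by
  have hcont : Continuous (𝓕⁻ h) := by
    have := VectorFourier.fourierIntegral_continuous (L := innerₗ E) Real.continuous_fourierChar
      continuous_inner h1
    have h3 : 𝓕⁻ h = fun x => 𝓕 h (-x) := funext fun x => Real.fourierInv_eq_fourier_neg h x
    rw [h3]
    exact this.comp continuous_neg
  -- Both sides are locally integrable, so it suffices to pair them with smooth compactly supported
  -- functions; these are Schwartz, and the `L²` transform agrees with the transform of tempered
  -- distributions.
  refine ae_eq_of_integral_contDiff_smul_eq ((Lp.memLp _).locallyIntegrable (by norm_num))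
    hcont.locallyIntegrable fun g hg hgc => ?_
  have hg₁ : HasCompactSupport (Complex.ofRealCLM ∘ g) := hgc.comp_left rfl
  have hg₂ : ContDiff ℝ (⊤ : ℕ∞) (Complex.ofRealCLM ∘ g) := by fun_prop
  set φ : 𝓢(E, ℂ) := hg₁.toSchwartzMap hg₂
  have hφ : ∀ x, φ x = (g x : ℂ) := fun x => rfl
  have e1 : (Lp.toTemperedDistribution (𝓕⁻ (h2.toLp h) : Lp F 2 (volume : Measure E))) φ =
      (Lp.toTemperedDistribution (h2.toLp h)) (𝓕⁻ φ) := by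
    rw [← Lp.fourierInv_toTemperedDistribution_eq, TemperedDistribution.fourierInv_apply]
  rw [Lp.toTemperedDistribution_apply, Lp.toTemperedDistribution_apply] at e1
  have e2 : ∫ x, (𝓕⁻ φ) x • (h2.toLp h : E → F) x = ∫ x, (𝓕⁻ φ) x • h x := by
    refine integral_congr_ae ?_
    filter_upwards [h2.coeFn_toLp] with x hx
    rw [hx]
  -- The multiplication formula moves the transform from `φ` to `h`; it is applied to `h(-x)` to
  -- pass from `𝓕` to `𝓕⁻`.
  have e3 : ∫ x, (𝓕⁻ φ) x • h x = ∫ x, φ x • 𝓕⁻ h x := by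
    rw [SchwartzMap.fourierInv_coe, Real.fourierInv_eq_fourier_comp_neg h]
    have h4 := VectorFourier.integral_fourierIntegral_smul_eq_flip (L := innerₗ E) (μ := volume)
      (ν := volume) (f := φ) (g := fun x => h (-x)) Real.continuous_fourierChar continuous_inner
      φ.integrable h1.comp_neg
    rw [flip_innerₗ] at h4
    refine Eq.trans ?_ h4
    rw [← integral_neg_eq_self]
    simp only [Real.fourierInv_eq_fourier_neg, neg_neg]
    rfl
  rw [e2, e3] at e1
  simpa only [hφ, Complex.coe_smul] using e1

theorem MeasureTheory.Integrable.bdd_fun_smul {α E : Type*} [MeasurableSpace α] {μ : Measure α}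
    [NormedAddCommGroup E] [NormedSpace ℂ E] {f : α → E} (hf : Integrable f μ) (φ : α → ℂ) (C : ℝ)
    (h1 : AEStronglyMeasurable φ μ) (h2 : ∀ᵐ a ∂μ, ‖φ a‖ ≤ C) :
    Integrable (fun a => φ a • f a) μ :=
  hf.bdd_smul C h1 h2

/-! ### Plancherel, inversion and the Hilbert module structure of the Paley–Wiener space. -/

namespace CliffordPW

variable {m : ℕ}

theorem memLp_comp_smul {c : ℝ} (hc : c ≠ 0) {F : Type*} [NormedAddCommGroup F] {p : ENNReal}
    {G : V m → F} (hG : MemLp G p volume) : MemLp (fun ξ => G (c • ξ)) p volume := by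
  refine MemLp.comp_of_map (f := fun ξ : V m => c • ξ) ?_ (measurable_const_smul _).aemeasurable
  rw [Measure.map_addHaar_smul _ hc]
  exact hG.smul_measure ENNReal.ofReal_ne_top

theorem fourierL2_two_pi_smul (f : L2 m) (η : V m) :
    fourierL2 f ((2 * Real.pi) • η) = (FourierTransform.fourier f : L2 m) η := by
  rw [fourierL2, smul_smul, inv_mul_cancel₀ Real.two_pi_pos.ne', one_smul]

theorem memLp_fourierL2 (f : L2 m) : MemLp (fourierL2 f) 2 volume :=
  memLp_comp_smul (inv_ne_zero Real.two_pi_pos.ne') (Lp.memLp _)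

theorem integral_two_pi_smul {F : Type*} [NormedAddCommGroup F] [NormedSpace ℝ F] (G : V m → F) :
    ∫ η, G ((2 * Real.pi) • η) = (((2 * Real.pi) ^ m)⁻¹ : ℝ) • ∫ ξ, G ξ := by
  rw [Measure.integral_comp_smul_of_nonneg _ _ _ (hR := Real.two_pi_pos.le)]
  simp

/-- Plancherel's theorem for `fourierL2`. -/
theorem inner_eq_integral_fourierL2 (f g : L2 m) :
    inner ℂ f g =
      (((2 * Real.pi) ^ m)⁻¹ : ℝ) • ∫ ξ, inner ℂ (fourierL2 f ξ) (fourierL2 g ξ) := by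
  rw [← Lp.inner_fourier_eq f g, ← integral_two_pi_smul, L2.inner_def]
  simp only [fourierL2_two_pi_smul]

theorem exists_fourierL2_eq {G : V m → Cl m} (hG : MemLp G 2 volume) :
    ∃ f : L2 m, fourierL2 f =ᵐ[volume] G := by
  have h2 := memLp_comp_smul Real.two_pi_pos.ne' hG
  refine ⟨FourierTransformInv.fourierInv (h2.toLp _), ?_⟩
  have h := ae_smul h2.coeFn_toLp
  filter_upwards [h] with ξ hξ
  rw [fourierL2, FourierTransform.fourier_fourierInv_eq, hξ, smul_smul,
    mul_inv_cancel₀ Real.two_pi_pos.ne', one_smul]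

/-- A compactly supported square integrable function on `R^m` is integrable. -/
theorem integrable_of_memLp_of_support {G : V m → Cl m} (hG : MemLp G 2 volume) {r : ℝ}
    (h0 : ∀ᵐ ξ : V m, ξ ∉ Metric.closedBall (0 : V m) r → G ξ = 0) : Integrable G volume := by
  have h1 : IntegrableOn G (Metric.closedBall (0 : V m) r) volume := by
    have := hG.restrict (Metric.closedBall (0 : V m) r)
    have hfin : IsFiniteMeasure (volume.restrict (Metric.closedBall (0 : V m) r)) :=
      ⟨by rw [Measure.restrict_apply_univ]; exact measure_closedBall_lt_top⟩
    exact this.integrable (by norm_num)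
  exact h1.integrable_of_ae_notMem_eq_zero h0

variable {R : ℝ}

theorem integrable_fourierL2 {f : L2 m} (hf : f ∈ PW m R) : Integrable (fourierL2 f) volume :=
  integrable_of_memLp_of_support (memLp_fourierL2 f) hf

/-- The Fourier inversion formula for `fourierL2`. -/
theorem ae_eq_integral_fourierL2 {f : L2 m} (hf : Integrable (fourierL2 f) volume) :
    f =ᵐ[volume] fun y => (((2 * Real.pi) ^ m)⁻¹ : ℝ) •
      ∫ ξ, Complex.exp (Complex.I * ((inner ℝ y ξ : ℝ) : ℂ)) • fourierL2 f ξ := by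
  have h1 : Integrable (FourierTransform.fourier f : L2 m) volume := by
    have := (integrable_comp_smul_iff volume (fourierL2 f) Real.two_pi_pos.ne').2 hf
    simpa only [fourierL2_two_pi_smul] using this
  have h2 : MemLp (FourierTransform.fourier f : L2 m) 2 volume := Lp.memLp _
  have h3 := h2.fourierInv_toLp_ae h1
  rw [Lp.toLp_coeFn, FourierTransform.fourierInv_fourier_eq] at h3
  filter_upwards [h3] with y hy
  rw [hy, Real.fourierInv_eq', ← integral_two_pi_smul]
  refine integral_congr_ae (Filter.Eventually.of_forall fun η => ?_)
  simp only [fourierL2_two_pi_smul, real_inner_smul_right, real_inner_comm y η]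
  congr 2
  ring

theorem coeFn_rmul (f : L2 m) (a : Cl m) : rmul f a =ᵐ[volume] fun y => f y * a :=
  ContinuousLinearMap.coeFn_compLp _ _

theorem integral_mul_right_cl {α : Type*} [MeasurableSpace α] {μ : Measure α} {G : α → Cl m}
    (hG : Integrable G μ) (a : Cl m) : ∫ x, G x * a ∂μ = (∫ x, G x ∂μ) * a := by
  have := ((mulCLM m).flip a).integral_comp_comm hG
  simpa using this

theorem integral_mul_left_cl {α : Type*} [MeasurableSpace α] {μ : Measure α} {G : α → Cl m}
    (hG : Integrable G μ) (a : Cl m) : ∫ x, a * G x ∂μ = a * ∫ x, G x ∂μ := by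
  have := (mulCLM m a).integral_comp_comm hG
  simpa using this

theorem memLp_mul_right {p : ENNReal} {α : Type*} [MeasurableSpace α] {μ : Measure α}
    {G : α → Cl m} (hG : MemLp G p μ) (a : Cl m) : MemLp (fun ξ => G ξ * a) p μ :=
  ((mulCLM m).flip a).comp_memLp' hG

theorem integrable_mul_right {α : Type*} [MeasurableSpace α] {μ : Measure α}
    {G : α → Cl m} (hG : Integrable G μ) (a : Cl m) : Integrable (fun ξ => G ξ * a) μ :=
  ((mulCLM m).flip a).integrable_comp hG

theorem integrable_mul_left {α : Type*} [MeasurableSpace α] {μ : Measure α}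
    {G : α → Cl m} (hG : Integrable G μ) (a : Cl m) : Integrable (fun ξ => a * G ξ) μ :=
  (mulCLM m a).integrable_comp hG

/-- Let `k` have transform `𝓕(f) a`. Inversion writes `k` and `f` as integrals, and right
multiplication by `a` commutes with the integral, so `k = f a`. -/
theorem fourierL2_rmul {f : L2 m} (hf : Integrable (fourierL2 f) volume) (a : Cl m) :
    fourierL2 (rmul f a) =ᵐ[volume] fun ξ => fourierL2 f ξ * a := by
  obtain ⟨k, hk⟩ := exists_fourierL2_eq (memLp_mul_right (memLp_fourierL2 f) a)
  have hki : Integrable (fourierL2 k) volume :=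
    (integrable_congr hk).2 (integrable_mul_right hf a)
  suffices rmul f a = k by rw [this]; exact hk
  refine Lp.ext ?_
  filter_upwards [coeFn_rmul f a, ae_eq_integral_fourierL2 hf, ae_eq_integral_fourierL2 hki]
    with y h1 h2 h3
  rw [h1, h2, h3]
  have h4 : ∫ ξ, Complex.exp (Complex.I * ((inner ℝ y ξ : ℝ) : ℂ)) • fourierL2 k ξ =
      ∫ ξ, (Complex.exp (Complex.I * ((inner ℝ y ξ : ℝ) : ℂ)) • fourierL2 f ξ) * a := by
    refine integral_congr_ae ?_
    filter_upwards [hk] with ξ hξ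
    rw [hξ, smul_mul_assoc]
  have h5 : Integrable (fun ξ => Complex.exp (Complex.I * ((inner ℝ y ξ : ℝ) : ℂ)) •
      fourierL2 f ξ) volume := by
    refine hf.bdd_fun_smul _ 1 (Continuous.aestronglyMeasurable (by fun_prop))
      (Filter.Eventually.of_forall fun ξ => ?_)
    rw [mul_comm, Complex.norm_exp_ofReal_mul_I]
  rw [h4, integral_mul_right_cl h5, ← Complex.coe_smul, ← Complex.coe_smul, smul_mul_assoc]

theorem rmul_mem {f : L2 m} (hf : f ∈ PW m R) (a : Cl m) : rmul f a ∈ PW m R := by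
  change ∀ᵐ ξ : V m, _
  have hf' : ∀ᵐ ξ : V m, ξ ∉ Metric.closedBall (0 : V m) R → fourierL2 f ξ = 0 := hf
  filter_upwards [fourierL2_rmul (integrable_fourierL2 hf) a, hf'] with ξ h1 h2 h3
  rw [h1, h2 h3, zero_mul]

/-- The Fourier transform is an isometry, and an `L²`-convergent sequence has a subsequence
converging almost everywhere, so the vanishing off the ball passes to the limit. -/
theorem isClosed_PW : IsClosed (PW m R : Set (L2 m)) := by
  refine IsSeqClosed.isClosed fun u f hu hlim => ?_
  have h1 : Filter.Tendsto (fun n => (FourierTransform.fourier (u n) : L2 m)) Filter.atTop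
      (nhds (FourierTransform.fourier f)) :=
    ((Lp.fourierTransformₗᵢ (V m) (Cl m)).continuous.tendsto f).comp hlim
  obtain ⟨ns, -, hns⟩ := (tendstoInMeasure_of_tendsto_Lp h1).exists_seq_tendsto_ae
  have h2 := ae_smul hns
  have h3 : ∀ᵐ ξ : V m, ∀ n, ξ ∉ Metric.closedBall (0 : V m) R → fourierL2 (u n) ξ = 0 :=
    ae_all_iff.2 fun n => hu n
  change ∀ᵐ ξ : V m, _
  filter_upwards [h2, h3] with ξ h4 h5 h6
  have h7 : (fun i => (FourierTransform.fourier (u (ns i)) : L2 m) ((2 * Real.pi)⁻¹ • ξ)) =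
      fun _ => 0 := funext fun i => h5 (ns i) h6
  rw [h7] at h4
  exact tendsto_nhds_unique h4 tendsto_const_nhds

instance : CompleteSpace (PW m R) := isClosed_PW.completeSpace_coe

/-- The product `conj g * f` of square integrable functions is integrable. -/
theorem integrable_conj_mul {f g : V m → Cl m} (hg : MemLp g 2 volume) (hf : MemLp f 2 volume) :
    Integrable (fun y => conj (g y) * f y) volume := by
  have hg' : MemLp (fun y => conj (g y)) 2 volume := (conjCLM m).comp_memLp' hg
  have h := MemLp.integrable_mul (p := 2) (q := 2) hg'.norm hf.norm
  refine (h.const_mul ‖mulCLM m‖).mono' ?_ (Filter.Eventually.of_forall fun y => ?_)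
  · exact continuous_mul_cl.comp_aestronglyMeasurable
      (hg'.aestronglyMeasurable.prodMk hf.aestronglyMeasurable)
  · have := norm_mul_le_mulCLM (conj (g y)) (f y)
    simpa [mul_assoc] using this

theorem Sc_integral {α : Type*} [MeasurableSpace α] {μ : Measure α} {G : α → Cl m}
    (hG : Integrable G μ) : Sc (∫ x, G x ∂μ) = ∫ x, Sc (G x) ∂μ := by
  simp only [← inner_one_left]
  exact (integral_inner hG 1).symm

theorem Sc_cInner (f g : L2 m) : Sc (cInner f g) = inner ℂ g f := by
  rw [cInner, Sc_integral (integrable_conj_mul (Lp.memLp g) (Lp.memLp f)), L2.inner_def]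
  simp only [Sc_conj_mul]

theorem conj_cInner (f g : L2 m) : conj (cInner f g) = cInner g f := by
  rw [cInner, ← conjCLM_apply,
    ← (conjCLM m).integral_comp_comm (integrable_conj_mul (Lp.memLp g) (Lp.memLp f))]
  simp only [conjCLM_apply, conj_mul, conj_conj]
  rfl

theorem cInner_add_left (f k g : L2 m) : cInner (f + k) g = cInner f g + cInner k g := by
  rw [cInner, cInner, cInner, ← integral_add (integrable_conj_mul (Lp.memLp g) (Lp.memLp f))
    (integrable_conj_mul (Lp.memLp g) (Lp.memLp k))]
  refine integral_congr_ae ?_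
  filter_upwards [Lp.coeFn_add f k] with y hy
  rw [hy, Pi.add_apply, mul_add]

theorem cInner_rmul_left (f g : L2 m) (a : Cl m) : cInner (rmul f a) g = cInner f g * a := by
  rw [cInner, cInner, ← integral_mul_right_cl (integrable_conj_mul (Lp.memLp g) (Lp.memLp f))]
  refine integral_congr_ae ?_
  filter_upwards [coeFn_rmul f a] with y hy
  rw [hy, mul_assoc]

theorem cInner_rmul_right (f g : L2 m) (a : Cl m) :
    cInner f (rmul g a) = conj a * cInner f g := by
  rw [← conj_cInner, cInner_rmul_left, conj_mul, conj_cInner]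

/-- Plancherel's theorem for the Clifford-valued inner product. -/
theorem cInner_eq_integral_fourierL2 {f g : L2 m} (hg : Integrable (fourierL2 g) volume) :
    cInner f g = (((2 * Real.pi) ^ m)⁻¹ : ℝ) • ∫ ξ, conj (fourierL2 g ξ) * fourierL2 f ξ := by
  -- A Clifford number is determined by the scalar parts of its products with all `conj u`; these
  -- turn the claim into the scalar Plancherel theorem for `f` and `g u`.
  refine ext_Sc fun u => ?_
  have hi := integrable_conj_mul (memLp_fourierL2 g) (memLp_fourierL2 f)
  rw [← cInner_rmul_right, Sc_cInner, inner_eq_integral_fourierL2, ← Complex.coe_smul,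
    ← Complex.coe_smul, mul_smul_comm, ← inner_one_left, inner_smul_right, inner_one_left,
    ← integral_mul_left_cl hi, Sc_integral (integrable_mul_left hi (conj u)), smul_eq_mul]
  congr 1
  refine integral_congr_ae ?_
  filter_upwards [fourierL2_rmul hg u] with ξ hξ
  rw [hξ, ← Sc_conj_mul, conj_mul, mul_assoc]

end CliffordPW

/-! ### Differentiation of integrals of exponentials `∫ exp(l_a(x)) c(a)`. -/

section ExpIntegral

variable {α W E : Type*} [MeasurableSpace α] {μ : Measure α}
  [NormedAddCommGroup W] [NormedSpace ℝ W] [NormedAddCommGroup E] [NormedSpace ℂ E]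
  {l : α → W →L[ℝ] ℂ} {c : α → E} {K : ℝ}

theorem Complex.norm_exp_clm_le {L : W →L[ℝ] ℂ} (hL : ‖L‖ ≤ K) (x : W) :
    ‖Complex.exp (L x)‖ ≤ Real.exp (K * ‖x‖) := by
  rw [Complex.norm_exp]
  exact Real.exp_le_exp.2 (((Complex.re_le_norm _).trans (L.le_opNorm x)).trans
    (mul_le_mul_of_nonneg_right hL (norm_nonneg _)))

theorem integrable_exp_smul (hl : AEStronglyMeasurable l μ) (hK : ∀ᵐ a ∂μ, ‖l a‖ ≤ K)
    (hc : Integrable c μ) (x : W) : Integrable (fun a => Complex.exp (l a x) • c a) μ := by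
  refine hc.bdd_fun_smul _ (Real.exp (K * ‖x‖)) ?_ ?_
  · exact Complex.continuous_exp.comp_aestronglyMeasurable
      ((ContinuousLinearMap.apply ℝ ℂ x).continuous.comp_aestronglyMeasurable hl)
  · filter_upwards [hK] with a ha using Complex.norm_exp_clm_le ha x

variable [NormedSpace ℝ E] [IsScalarTower ℝ ℂ E]

theorem integrable_lsmul_comp (hl : AEStronglyMeasurable l μ) (hK : ∀ᵐ a ∂μ, ‖l a‖ ≤ K)
    (hc : Integrable c μ) :
    Integrable (fun a => ((ContinuousLinearMap.lsmul ℝ ℂ).flip (c a) ∘L l a : W →L[ℝ] E)) μ := by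
  have h1 : Integrable (fun a => (ContinuousLinearMap.lsmul ℝ ℂ (E := E)).flip (c a)) μ :=
    ((ContinuousLinearMap.lsmul ℝ ℂ (E := E)).flip).integrable_comp hc
  refine (h1.norm.mul_const K).mono' ?_ ?_
  · have : Continuous fun p : (ℂ →L[ℝ] E) × (W →L[ℝ] ℂ) => p.1 ∘L p.2 := by fun_prop
    exact this.comp_aestronglyMeasurable (h1.aestronglyMeasurable.prodMk hl)
  · filter_upwards [hK] with a ha
    exact (ContinuousLinearMap.opNorm_comp_le _ _).trans
      (mul_le_mul_of_nonneg_left ha (norm_nonneg _))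

/-- Differentiation under the integral: on the unit ball around `x₀` the exponential is at most
`exp(|K|(‖x₀‖ + 1))`, which gives an integrable majorant. -/
theorem hasFDerivAt_integral_exp_smul (hl : AEStronglyMeasurable l μ)
    (hK : ∀ᵐ a ∂μ, ‖l a‖ ≤ K) (hc : Integrable c μ) (x₀ : W) :
    HasFDerivAt (fun x => ∫ a, Complex.exp (l a x) • c a ∂μ)
      (∫ a, Complex.exp (l a x₀) •
        ((ContinuousLinearMap.lsmul ℝ ℂ).flip (c a) ∘L l a : W →L[ℝ] E) ∂μ) x₀ := by
  have h1 := integrable_lsmul_comp hl hK hc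
  refine hasFDerivAt_integral_of_dominated_of_fderiv_le (𝕜 := ℝ)
    (bound := fun a => Real.exp (|K| * (‖x₀‖ + 1)) *
      ‖((ContinuousLinearMap.lsmul ℝ ℂ).flip (c a) ∘L l a : W →L[ℝ] E)‖)
    (F' := fun x a => Complex.exp (l a x) •
        ((ContinuousLinearMap.lsmul ℝ ℂ).flip (c a) ∘L l a : W →L[ℝ] E))
    (Metric.ball_mem_nhds x₀ one_pos)
    (Filter.Eventually.of_forall fun x => (integrable_exp_smul hl hK hc x).aestronglyMeasurable)
    (integrable_exp_smul hl hK hc x₀) (integrable_exp_smul hl hK h1 x₀).aestronglyMeasurable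
    ?_ (h1.norm.const_mul _) ?_
  · filter_upwards [hK] with a ha x hx
    rw [norm_smul]
    refine mul_le_mul_of_nonneg_right ((Complex.norm_exp_clm_le (ha.trans (le_abs_self K)) x).trans
      (Real.exp_le_exp.2 (mul_le_mul_of_nonneg_left ?_ (abs_nonneg K)))) (norm_nonneg _)
    have h2 : ‖x - x₀‖ < 1 := by simpa [dist_eq_norm] using hx
    have h3 : ‖x‖ ≤ ‖x₀‖ + ‖x - x₀‖ := by simpa using norm_add_le x₀ (x - x₀)
    linarith
  · refine Filter.Eventually.of_forall fun a x _ => ?_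
    have h2 : HasFDerivAt (fun x => Complex.exp (l a x)) (Complex.exp (l a x) • l a) x :=
      (l a).hasFDerivAt.cexp
    convert! h2.smul_const (c a) using 1
    ext v
    simp [mul_smul]

theorem contDiff_integral_exp_smul (hl : AEStronglyMeasurable l μ)
    (hK : ∀ᵐ a ∂μ, ‖l a‖ ≤ K) (hc : Integrable c μ) :
    ContDiff ℝ 1 (fun x => ∫ a, Complex.exp (l a x) • c a ∂μ) := by
  rw [contDiff_one_iff_fderiv]
  have h1 := hasFDerivAt_integral_exp_smul hl hK hc
  refine ⟨fun x => (h1 x).differentiableAt, ?_⟩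
  have h2 : fderiv ℝ (fun x => ∫ a, Complex.exp (l a x) • c a ∂μ) = _ :=
    funext fun x => (h1 x).fderiv
  rw [h2]
  -- The derivative is an integral of the same type, with operator-valued coefficients; it is
  -- therefore differentiable itself, and in particular continuous.
  exact continuous_iff_continuousAt.2 fun x => (hasFDerivAt_integral_exp_smul hl hK
    (integrable_lsmul_comp hl hK hc) x).continuousAt

theorem fderiv_integral_exp_smul_apply (hl : AEStronglyMeasurable l μ)
    (hK : ∀ᵐ a ∂μ, ‖l a‖ ≤ K) (hc : Integrable c μ) [CompleteSpace E] (x v : W) :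
    fderiv ℝ (fun x => ∫ a, Complex.exp (l a x) • c a ∂μ) x v =
      ∫ a, Complex.exp (l a x) • l a v • c a ∂μ := by
  rw [(hasFDerivAt_integral_exp_smul hl hK hc x).fderiv]
  have h := integrable_exp_smul hl hK (integrable_lsmul_comp hl hK hc) x
  have h2 := (ContinuousLinearMap.apply ℝ E v).integral_comp_comm h
  simp only [ContinuousLinearMap.apply_apply] at h2
  rw [← h2]
  rfl

end ExpIntegral

/-! ### The exponentials `e(x, ξ)` and the monogenic extension. -/

namespace CliffordPW

variable {m : ℕ}

/-- The real-linear form `x ↦ i ⟨x_, ξ⟩ - s x_0 |ξ|`. -/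
noncomputable def phase (s : ℝ) (ξ : V m) : X m →L[ℝ] ℂ :=
  Complex.I • (Complex.ofRealCLM ∘L innerSL ℝ ξ ∘L WithLp.sndL 2 ℝ ℝ (V m)) -
    (s * ‖ξ‖) • (Complex.ofRealCLM ∘L WithLp.fstL 2 ℝ ℝ (V m))

theorem phase_apply (s : ℝ) (ξ : V m) (x : X m) :
    phase s ξ x = Complex.I * ((inner ℝ x.snd ξ : ℝ) : ℂ) - ((s * (x.fst * ‖ξ‖) : ℝ) : ℂ) := by
  simp only [phase, sub_apply, smul_apply,
    ContinuousLinearMap.comp_apply, innerSL_apply_apply, Complex.ofRealCLM_apply, smul_eq_mul,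
    Complex.real_smul, real_inner_comm]
  push_cast
  change Complex.I * _ - _ * (x.fst : ℂ) = _
  congr 1
  ring

theorem continuous_phase (s : ℝ) : Continuous (phase s : V m → X m →L[ℝ] ℂ) := by
  unfold phase
  fun_prop

theorem ePlus_eq (x : X m) (ξ : V m) : ePlus x ξ = Complex.exp (phase 1 ξ x) • chiPlus ξ := by
  rw [ePlus, phase_apply, ← Complex.exp_add]
  congr 2
  push_cast
  ring

theorem eMinus_eq (x : X m) (ξ : V m) : eMinus x ξ = Complex.exp (phase (-1) ξ x) • chiMinus ξ := by
  rw [eMinus, phase_apply, ← Complex.exp_add]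
  congr 2
  push_cast
  ring

theorem norm_exp_phase_le {s : ℝ} (hs : |s| = 1) (x : X m) (ξ : V m) :
    ‖Complex.exp (phase s ξ x)‖ ≤ Real.exp (‖ξ‖ * ‖x‖) := by
  rw [phase_apply, Complex.norm_exp]
  refine Real.exp_le_exp.2 ?_
  have h : (Complex.I * ((inner ℝ x.snd ξ : ℝ) : ℂ) - ((s * (x.fst * ‖ξ‖) : ℝ) : ℂ)).re =
      -(s * (x.fst * ‖ξ‖)) := by
    simp [Complex.sub_re, Complex.mul_re, -Complex.ofReal_mul]
  rw [h]
  have h1 : |x.fst| ≤ ‖x‖ := WithLp.norm_fst_le _ x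
  calc -(s * (x.fst * ‖ξ‖)) ≤ |-(s * (x.fst * ‖ξ‖))| := le_abs_self _
    _ = |x.fst| * ‖ξ‖ := by rw [abs_neg, abs_mul, hs, one_mul, abs_mul, abs_norm]
    _ ≤ ‖ξ‖ * ‖x‖ := by rw [mul_comm]; exact mul_le_mul_of_nonneg_left h1 (norm_nonneg _)

theorem norm_eFun_le (x : X m) (ξ : V m) :
    ‖eFun x ξ‖ ≤ 2 * ‖(1 : Cl m)‖ * Real.exp (‖ξ‖ * ‖x‖) := by
  have h1 : ‖ePlus x ξ‖ ≤ Real.exp (‖ξ‖ * ‖x‖) * ‖(1 : Cl m)‖ := by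
    rw [ePlus_eq, norm_smul]
    exact mul_le_mul (norm_exp_phase_le (by simp) x ξ) (norm_chiPlus_le ξ) (norm_nonneg _)
      (Real.exp_pos _).le
  have h2 : ‖eMinus x ξ‖ ≤ Real.exp (‖ξ‖ * ‖x‖) * ‖(1 : Cl m)‖ := by
    rw [eMinus_eq, norm_smul]
    exact mul_le_mul (norm_exp_phase_le (by simp) x ξ) (norm_chiMinus_le ξ) (norm_nonneg _)
      (Real.exp_pos _).le
  have h3 := norm_add_le (ePlus x ξ) (eMinus x ξ)
  rw [eFun]
  linarith

theorem norm_phase_le {s : ℝ} (hs : |s| = 1) (ξ : V m) : ‖phase s ξ‖ ≤ 2 * ‖ξ‖ := by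
  refine ContinuousLinearMap.opNorm_le_bound _ (by positivity) fun x => ?_
  rw [phase_apply]
  refine (norm_sub_le _ _).trans ?_
  rw [norm_mul, Complex.norm_I, one_mul, Complex.norm_real, Complex.norm_real, Real.norm_eq_abs,
    Real.norm_eq_abs, abs_mul, hs, one_mul, abs_mul, abs_norm]
  have h1 : |x.fst| ≤ ‖x‖ := WithLp.norm_fst_le _ x
  have h2 : ‖x.snd‖ ≤ ‖x‖ := WithLp.norm_snd_le _ x
  have h3 := abs_real_inner_le_norm x.snd ξ
  nlinarith [norm_nonneg ξ]

theorem continuous_vec : Continuous (vec : V m → Cl m) := by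
  unfold vec
  fun_prop

theorem stronglyMeasurable_chiPlus : StronglyMeasurable (chiPlus : V m → Cl m) := by
  have h : Measurable fun ξ : V m => Complex.I / (‖ξ‖ : ℂ) := by fun_prop
  exact (stronglyMeasurable_const.add
    (h.stronglyMeasurable.smul continuous_vec.stronglyMeasurable)).const_smul (1 / 2 : ℂ)

theorem stronglyMeasurable_chiMinus : StronglyMeasurable (chiMinus : V m → Cl m) := by
  have h : (chiMinus : V m → Cl m) = fun ξ => 1 - chiPlus ξ := funext chiMinus_eq
  rw [h]
  exact stronglyMeasurable_const.sub stronglyMeasurable_chiPlus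

theorem stronglyMeasurable_eFun (x : X m) : StronglyMeasurable (eFun x) := by
  have h : ∀ s, Continuous fun ξ : V m => Complex.exp (phase s ξ x) := fun s =>
    Complex.continuous_exp.comp ((ContinuousLinearMap.apply ℝ ℂ x).continuous.comp
      (continuous_phase s))
  have h1 : eFun x = fun ξ => Complex.exp (phase 1 ξ x) • chiPlus ξ +
      Complex.exp (phase (-1) ξ x) • chiMinus ξ := funext fun ξ => by
    rw [eFun, ePlus_eq, eMinus_eq]
  rw [h1]
  exact ((h 1).stronglyMeasurable.smul stronglyMeasurable_chiPlus).add
    ((h (-1)).stronglyMeasurable.smul stronglyMeasurable_chiMinus)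

theorem integrable_bdd_mul {μ : Measure (V m)} {A G : V m → Cl m} {C : ℝ}
    (hA : AEStronglyMeasurable A μ) (hC : ∀ᵐ ξ ∂μ, ‖A ξ‖ ≤ C) (hG : Integrable G μ) :
    Integrable (fun ξ => A ξ * G ξ) μ := by
  refine (hG.norm.const_mul (‖mulCLM m‖ * C)).mono' ?_ ?_
  · exact continuous_mul_cl.comp_aestronglyMeasurable (hA.prodMk hG.aestronglyMeasurable)
  · filter_upwards [hC] with ξ hξ
    exact (norm_mul_le_mulCLM _ _).trans (mul_le_mul_of_nonneg_right
      (mul_le_mul_of_nonneg_left hξ (norm_nonneg _)) (norm_nonneg _))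

/-- The function `x ↦ (2π)^(-m) ∫_{B(0,R)} e(x, ξ) G(ξ) dξ`. -/
noncomputable def pwExt (R : ℝ) (G : V m → Cl m) (x : X m) : Cl m :=
  (((2 * Real.pi) ^ m)⁻¹ : ℝ) •
    ∫ ξ : V m, (Metric.ball 0 R).indicator (fun ξ => eFun x ξ * G ξ) ξ

variable {R : ℝ} {G : V m → Cl m}

theorem ae_mem_ball : ∀ᵐ ξ ∂(volume.restrict (Metric.ball (0 : V m) R)), ‖ξ‖ ≤ R := by
  filter_upwards [ae_restrict_mem measurableSet_ball] with ξ hξ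
  exact (mem_ball_zero_iff.1 hξ).le

theorem norm_eFun_le_of_le {x : X m} {ξ : V m} (h : ‖ξ‖ ≤ R) :
    ‖eFun x ξ‖ ≤ 2 * ‖(1 : Cl m)‖ * Real.exp (R * ‖x‖) :=
  (norm_eFun_le x ξ).trans (mul_le_mul_of_nonneg_left (Real.exp_le_exp.2
    (mul_le_mul_of_nonneg_right h (norm_nonneg _))) (by positivity))

theorem integrable_eFun_mul (hG : Integrable G volume) (x : X m) :
    Integrable (fun ξ => eFun x ξ * G ξ) (volume.restrict (Metric.ball (0 : V m) R)) :=
  integrable_bdd_mul (stronglyMeasurable_eFun x).aestronglyMeasurable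
    (ae_mem_ball.mono fun _ h => norm_eFun_le_of_le h) hG.restrict

theorem norm_pwExt_le (hG : Integrable G volume) (x : X m) :
    ‖pwExt R G x‖ ≤ ((2 * Real.pi) ^ m)⁻¹ * (‖mulCLM m‖ * (2 * ‖(1 : Cl m)‖ * Real.exp (R * ‖x‖)) *
      ∫ ξ in Metric.ball (0 : V m) R, ‖G ξ‖) := by
  rw [pwExt, integral_indicator measurableSet_ball, norm_smul, Real.norm_of_nonneg (by positivity)]
  refine mul_le_mul_of_nonneg_left ?_ (by positivity)
  rw [← integral_const_mul]
  refine norm_integral_le_of_norm_le (hG.restrict.norm.const_mul _) ?_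
  filter_upwards [ae_mem_ball] with ξ hξ
  exact (norm_mul_le_mulCLM _ _).trans (mul_le_mul_of_nonneg_right
    (mul_le_mul_of_nonneg_left (norm_eFun_le_of_le hξ) (norm_nonneg _)) (norm_nonneg _))

theorem para_fst (s : ℝ) (v : V m) : (para s v).fst = s := rfl
theorem para_snd (s : ℝ) (v : V m) : (para s v).snd = v := rfl

theorem phase_para_one_zero (s : ℝ) (ξ : V m) : phase s ξ (para 1 0) = -((s * ‖ξ‖ : ℝ) : ℂ) := by
  rw [phase_apply, para_fst, para_snd]
  simp

theorem phase_para_zero_single (s : ℝ) (ξ : V m) (j : Fin m) :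
    phase s ξ (para 0 (EuclideanSpace.single j 1)) = Complex.I * (ξ j : ℂ) := by
  rw [phase_apply, para_fst, para_snd]
  simp [EuclideanSpace.inner_single_left]

theorem dirac_add {F₁ F₂ : X m → Cl m} {x : X m} (h₁ : DifferentiableAt ℝ F₁ x)
    (h₂ : DifferentiableAt ℝ F₂ x) : dirac (fun x => F₁ x + F₂ x) x = dirac F₁ x + dirac F₂ x := by
  unfold dirac
  rw [fderiv_fun_add h₁ h₂]
  simp only [add_apply, mul_add, Finset.sum_add_distrib]
  abel

theorem dirac_smul (c : ℝ) {F : X m → Cl m} {x : X m} (h : DifferentiableAt ℝ F x) :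
    dirac (fun x => c • F x) x = c • dirac F x := by
  unfold dirac
  rw [fderiv_fun_const_smul h]
  simp only [smul_apply, ← Complex.coe_smul, mul_smul_comm, smul_add,
    Finset.smul_sum]

theorem IsLeftMonogenic.add {F₁ F₂ : X m → Cl m} (h₁ : IsLeftMonogenic F₁)
    (h₂ : IsLeftMonogenic F₂) : IsLeftMonogenic (fun x => F₁ x + F₂ x) :=
  ⟨h₁.1.add h₂.1, fun x => by
    rw [dirac_add (h₁.1.differentiable one_ne_zero x) (h₂.1.differentiable one_ne_zero x), h₁.2,
      h₂.2, add_zero]⟩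

theorem IsLeftMonogenic.const_smul (c : ℝ) {F : X m → Cl m} (h : IsLeftMonogenic F) :
    IsLeftMonogenic (fun x => c • F x) :=
  ⟨h.1.const_smul c, fun x => by
    rw [dirac_smul c (h.1.differentiable one_ne_zero x), h.2, smul_zero]⟩

/-- Superpositions of monogenic exponentials are monogenic. -/
theorem isLeftMonogenic_integral_exp {s : ℝ} (hs : |s| = 1) {c : V m → Cl m}
    (hc : Integrable c (volume.restrict (Metric.ball (0 : V m) R)))
    (h0 : ∀ ξ, Complex.I • (vec ξ * c ξ) = ((s * ‖ξ‖ : ℝ) : ℂ) • c ξ) :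
    IsLeftMonogenic (fun x => ∫ ξ in Metric.ball (0 : V m) R, Complex.exp (phase s ξ x) • c ξ) := by
  have hl : AEStronglyMeasurable (phase s : V m → X m →L[ℝ] ℂ)
      (volume.restrict (Metric.ball (0 : V m) R)) := (continuous_phase s).aestronglyMeasurable
  have hK : ∀ᵐ ξ ∂(volume.restrict (Metric.ball (0 : V m) R)), ‖phase s ξ‖ ≤ 2 * R := by
    filter_upwards [ae_mem_ball] with ξ hξ
    linarith [norm_phase_le hs ξ]
  refine ⟨contDiff_integral_exp_smul hl hK hc, fun x => ?_⟩
  have hint : ∀ v, Integrable (fun ξ => Complex.exp (phase s ξ x) • phase s ξ v • c ξ)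
      (volume.restrict (Metric.ball (0 : V m) R)) := fun v => by
    refine integrable_exp_smul hl hK (hc.bdd_fun_smul _ (2 * R * ‖v‖) ?_ ?_) x
    · exact (ContinuousLinearMap.apply ℝ ℂ v).continuous.comp_aestronglyMeasurable hl
    · filter_upwards [hK] with ξ hξ
      exact ((phase s ξ).le_opNorm v).trans (mul_le_mul_of_nonneg_right hξ (norm_nonneg _))
  simp only [dirac, fderiv_integral_exp_smul_apply hl hK hc]
  simp only [← integral_mul_left_cl (hint _)]
  rw [← integral_finsetSum _ fun j _ => integrable_mul_left (hint _) _,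
    ← integral_add (hint _) (integrable_finsetSum _ fun j _ => integrable_mul_left (hint _) _)]
  refine integral_eq_zero_of_ae (Filter.Eventually.of_forall fun ξ => ?_)
  -- On the integrand the Dirac operator acts as multiplication by `-s|ξ| + iξ`, which annihilates
  -- `c ξ` by `h0`.
  have h1 : ∑ j, gen j * Complex.exp (phase s ξ x) •
      phase s ξ (para 0 (EuclideanSpace.single j 1)) • c ξ =
      Complex.exp (phase s ξ x) • Complex.I • (vec ξ * c ξ) := by
    rw [vec, Finset.sum_mul, Finset.smul_sum, Finset.smul_sum]
    refine Finset.sum_congr rfl fun j _ => ?_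
    rw [phase_para_zero_single, mul_smul_comm, mul_smul_comm, smul_mul_assoc, mul_smul]
  simp only [h1, h0, phase_para_one_zero, ← smul_add, neg_smul, neg_add_cancel, smul_zero,
    Pi.zero_apply]

theorem isLeftMonogenic_pwExt (hG : Integrable G volume) : IsLeftMonogenic (pwExt R G) := by
  have h1 : Integrable (fun ξ => chiPlus ξ * G ξ) (volume.restrict (Metric.ball (0 : V m) R)) :=
    integrable_bdd_mul stronglyMeasurable_chiPlus.aestronglyMeasurable
      (Filter.Eventually.of_forall norm_chiPlus_le) hG.restrict
  have h2 : Integrable (fun ξ => chiMinus ξ * G ξ) (volume.restrict (Metric.ball (0 : V m) R)) :=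
    integrable_bdd_mul stronglyMeasurable_chiMinus.aestronglyMeasurable
      (Filter.Eventually.of_forall norm_chiMinus_le) hG.restrict
  have m1 := isLeftMonogenic_integral_exp (s := 1) (by simp) h1 fun ξ => by
    rw [← mul_assoc, ← smul_mul_assoc, I_smul_vec_mul_chiPlus, one_mul, smul_mul_assoc]
  have m2 := isLeftMonogenic_integral_exp (s := -1) (by simp) h2 fun ξ => by
    rw [← mul_assoc, ← smul_mul_assoc, I_smul_vec_mul_chiMinus, neg_one_mul, neg_mul,
      smul_mul_assoc, Complex.ofReal_neg, neg_smul]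
  have hl : ∀ s, AEStronglyMeasurable (phase s : V m → X m →L[ℝ] ℂ)
      (volume.restrict (Metric.ball (0 : V m) R)) := fun s =>
    (continuous_phase s).aestronglyMeasurable
  have hK : ∀ s : ℝ, |s| = 1 →
      ∀ᵐ ξ ∂(volume.restrict (Metric.ball (0 : V m) R)), ‖phase s ξ‖ ≤ 2 * R := fun s hs => by
    filter_upwards [ae_mem_ball] with ξ hξ
    linarith [norm_phase_le hs ξ]
  convert! (m1.add m2).const_smul ((2 * Real.pi) ^ m)⁻¹ using 1
  funext x
  rw [pwExt, integral_indicator measurableSet_ball,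
    ← integral_add (integrable_exp_smul (hl 1) (hK 1 (by simp)) h1 x)
      (integrable_exp_smul (hl (-1)) (hK (-1) (by simp)) h2 x)]
  congr 2
  funext ξ
  rw [eFun, ePlus_eq, eMinus_eq, add_mul, smul_mul_assoc, smul_mul_assoc]

theorem eFun_para_zero (y ξ : V m) :
    eFun (para 0 y) ξ = Complex.exp (Complex.I * ((inner ℝ y ξ : ℝ) : ℂ)) • 1 := by
  rw [eFun, ePlus_eq, eMinus_eq, phase_apply, phase_apply, para_fst, para_snd, chiMinus_eq]
  simp only [zero_mul, mul_zero, Complex.ofReal_zero, sub_zero, ← smul_add, add_sub_cancel]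

/-- Reconciles the closed ball in `PW` with the open ball in the kernel: the sphere is a null set.
-/
theorem ae_ball_eq_zero (hR : 0 < R)
    (h0 : ∀ᵐ ξ : V m, ξ ∉ Metric.closedBall (0 : V m) R → G ξ = 0) :
    ∀ᵐ ξ : V m, ξ ∉ Metric.ball (0 : V m) R → G ξ = 0 := by
  have hs : ∀ᵐ ξ : V m, ξ ∉ Metric.sphere (0 : V m) R :=
    measure_eq_zero_iff_ae_notMem.1 (Measure.addHaar_sphere_of_ne_zero _ _ hR.ne')
  filter_upwards [h0, hs] with ξ h1 h2 h3
  refine h1 fun h4 => ?_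
  rw [← Metric.ball_union_sphere] at h4
  exact h4.elim h3 h2

theorem pwExt_para_zero_ae {f : L2 m} (hR : 0 < R) (hf : f ∈ PW m R) :
    (fun y : V m => pwExt R (fourierL2 f) (para 0 y)) =ᵐ[volume] f := by
  have h0 := ae_ball_eq_zero hR hf
  filter_upwards [ae_eq_integral_fourierL2 (integrable_fourierL2 hf)] with y hy
  rw [hy, pwExt]
  congr 1
  refine integral_congr_ae ?_
  filter_upwards [h0] with ξ hξ
  by_cases h : ξ ∈ Metric.ball (0 : V m) R
  · rw [Set.indicator_of_mem h, eFun_para_zero, smul_mul_assoc, one_mul]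
  · rw [Set.indicator_of_notMem h, hξ h, smul_zero]

theorem isExtension_pwExt {f : L2 m} (hR : 0 < R) (hf : f ∈ PW m R) :
    IsExtension R f (pwExt R (fourierL2 f)) where
  monogenic := isLeftMonogenic_pwExt (integrable_fourierL2 hf)
  restrict := pwExt_para_zero_ae hR hf
  bound := ⟨((2 * Real.pi) ^ m)⁻¹ * (‖mulCLM m‖ * (2 * ‖(1 : Cl m)‖) *
      ∫ ξ in Metric.ball (0 : V m) R, ‖fourierL2 f ξ‖), fun x =>
    (norm_pwExt_le (integrable_fourierL2 hf) x).trans (le_of_eq (by ring))⟩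

end CliffordPW

/-! ### A uniqueness theorem for first order elliptic systems -/

section Ode

variable {N N' N'' : ℝ → ℝ} {k : ℝ}

/-- A Carleman estimate in one variable. For `M(s) = exp(-2α(s - t₀)) N(s)` the hypothesis says `M''
≥ -k M`, so on an interval of length `τ ≤ k^(-1/2)` starting at a zero, `M` is at most twice its
value at the right end. The bound is uniform in `α`, which is later sent to infinity. -/
theorem le_exp_mul_of_second_order (hk : 0 ≤ k) (h1 : ∀ t, HasDerivAt N (N' t) t)
    (h2 : ∀ t, HasDerivAt N' (N'' t) t) (h0 : ∀ t, 0 ≤ N t)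
    (hode : ∀ α t, -k * N t ≤ N'' t - 4 * α * N' t + 4 * α ^ 2 * N t)
    {t₀ τ t : ℝ} (hz : N t₀ = 0) (hτ : k * τ ^ 2 ≤ 1) (ht : t₀ ≤ t) (ht' : t ≤ t₀ + τ) (α : ℝ) :
    N t ≤ 2 * N (t₀ + τ) * Real.exp (-(2 * (t₀ + τ - t)) * α) := by
  set e : ℝ → ℝ := fun s => Real.exp (-2 * α * (s - t₀)) with he
  have he' : ∀ s, HasDerivAt e (-2 * α * e s) s := fun s => by
    have := (((hasDerivAt_id s).sub_const t₀).const_mul (-2 * α)).exp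
    simp only [id, mul_one] at this
    rw [mul_comm]
    exact this
  set M : ℝ → ℝ := fun s => e s * N s with hM
  have hM1 : ∀ s, HasDerivAt M (e s * (N' s - 2 * α * N s)) s := fun s =>
    ((he' s).mul (h1 s)).congr_deriv (by ring)
  have hM2 : ∀ s, HasDerivAt (fun s => e s * (N' s - 2 * α * N s))
      (e s * (N'' s - 4 * α * N' s + 4 * α ^ 2 * N s)) s := fun s =>
    ((he' s).mul ((h2 s).sub ((h1 s).const_mul (2 * α)))).congr_deriv
      (by simp only [Pi.sub_apply]; ring)
  have hepos : ∀ s, 0 < e s := fun s => Real.exp_pos _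
  have hMc : Continuous M := continuous_iff_continuousAt.2 fun s => (hM1 s).continuousAt
  have hle : t₀ ≤ t₀ + τ := ht.trans ht'
  obtain ⟨s, hs, hmax⟩ := isCompact_Icc.exists_isMaxOn (Set.nonempty_Icc.2 hle) hMc.continuousOn
  have hS0 : 0 ≤ M s := mul_nonneg (hepos s).le (h0 s)
  set S := M s with hS
  have hq : ∀ x, HasDerivAt (fun x => k * S / 2 * (x - t₀) ^ 2) (k * S * (x - t₀)) x := fun x => by
    have := (((hasDerivAt_id x).sub_const t₀).pow 2).const_mul (k * S / 2)
    refine this.congr_deriv ?_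
    simp
    ring
  have hq' : ∀ x, HasDerivAt (fun x => k * S * (x - t₀)) (k * S) x := fun x => by
    simpa using ((hasDerivAt_id x).sub_const t₀).const_mul (k * S)
  -- With `S` the maximum of `M`, `M'' ≥ -kM ≥ -kS`, and the quadratic term compensates for this.
  have hconv : ConvexOn ℝ (Set.Icc t₀ (t₀ + τ)) (fun x => M x + k * S / 2 * (x - t₀) ^ 2) := by
    refine convexOn_of_hasDerivWithinAt2_nonneg (convex_Icc _ _) ?_
      (f' := fun x => e x * (N' x - 2 * α * N x) + k * S * (x - t₀))
      (f'' := fun x => e x * (N'' x - 4 * α * N' x + 4 * α ^ 2 * N x) + k * S)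
      (fun x _ => ((hM1 x).add (hq x)).hasDerivWithinAt)
      (fun x _ => ((hM2 x).add (hq' x)).hasDerivWithinAt) ?_
    · exact (hMc.add (by fun_prop)).continuousOn
    · intro x hx
      have hx' := interior_subset hx
      have h3 : M x ≤ S := hmax hx'
      have h4 := mul_le_mul_of_nonneg_left (hode α x) (hepos x).le
      have h5 : e x * (-k * N x) = -(k * M x) := by simp only [hM]; ring
      have h6 := mul_le_mul_of_nonneg_left h3 hk
      linarith
  have h7 := hconv.le_max_of_mem_Icc (Set.left_mem_Icc.2 hle) (Set.right_mem_Icc.2 hle) hs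
  have h8 : M t₀ = 0 := by simp [hM, hz]
  simp only [h8, sub_self, add_sub_cancel_left] at h7
  -- A convex function is bounded by its values at the ends: `0` at the left, at most `M(t₀ + τ) +
  -- S/2` at the right since `kτ² ≤ 1`.
  have h9 : S ≤ M (t₀ + τ) + S / 2 := by
    have h10 : 0 ≤ M (t₀ + τ) := mul_nonneg (hepos _).le (h0 _)
    have h11 : k * S / 2 * τ ^ 2 ≤ S / 2 := by nlinarith
    have h12 : 0 ≤ k * S / 2 * (s - t₀) ^ 2 := by positivity
    rcases le_max_iff.1 h7 with h | h
    · norm_num at h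
      linarith
    · linarith
  have h13 : M t ≤ S := hmax ⟨ht, ht'⟩
  have h14 : e t * N t ≤ 2 * (e (t₀ + τ) * N (t₀ + τ)) := by
    change M t ≤ 2 * M (t₀ + τ)
    linarith
  have h15 : Real.exp (-(2 * (t₀ + τ - t)) * α) = e (t₀ + τ) / e t := by
    rw [he, ← Real.exp_sub]
    congr 1
    ring
  rw [h15, mul_div_assoc', le_div_iff₀ (hepos t)]
  linarith

theorem eq_zero_of_second_order_right (hk : 0 < k) (h1 : ∀ t, HasDerivAt N (N' t) t)
    (h2 : ∀ t, HasDerivAt N' (N'' t) t) (h0 : ∀ t, 0 ≤ N t)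
    (hode : ∀ α t, -k * N t ≤ N'' t - 4 * α * N' t + 4 * α ^ 2 * N t) (hz : N 0 = 0)
    {t : ℝ} (ht : 0 ≤ t) : N t = 0 := by
  set τ : ℝ := (Real.sqrt k)⁻¹ with hτ
  have hτ0 : 0 < τ := inv_pos.2 (Real.sqrt_pos.2 hk)
  have hτk : k * τ ^ 2 ≤ 1 := by
    rw [hτ, inv_pow, Real.sq_sqrt hk.le, mul_inv_cancel₀ hk.ne']
  have step : ∀ t₀, N t₀ = 0 → ∀ t, t₀ ≤ t → t < t₀ + τ → N t = 0 := by
    intro t₀ hz t ht ht'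
    refine le_antisymm ?_ (h0 t)
    have hlim : Filter.Tendsto (fun α => 2 * N (t₀ + τ) * Real.exp (-(2 * (t₀ + τ - t)) * α))
        Filter.atTop (nhds (2 * N (t₀ + τ) * 0)) := by
      refine Filter.Tendsto.const_mul _ (Real.tendsto_exp_atBot.comp ?_)
      exact Filter.tendsto_id.const_mul_atTop_of_neg (by linarith)
    rw [mul_zero] at hlim
    exact ge_of_tendsto' hlim
      (le_exp_mul_of_second_order hk.le h1 h2 h0 hode hz hτk ht ht'.le)
  -- The limit `α → ∞` gives vanishing only for `t < t₀ + τ`, strictly; steps of length `τ/2` stay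
  -- inside.
  have hn : ∀ n : ℕ, N (n * (τ / 2)) = 0 := by
    intro n
    induction n with
    | zero => simpa using hz
    | succ n ih =>
      refine step _ ih _ ?_ ?_
      · push_cast; linarith
      · push_cast; linarith
  have h3 : (⌊t / (τ / 2)⌋₊ : ℝ) * (τ / 2) ≤ t :=
    (le_div_iff₀ (by positivity)).1 (Nat.floor_le (by positivity))
  have h4 : t < (⌊t / (τ / 2)⌋₊ + 1 : ℝ) * (τ / 2) :=
    (div_lt_iff₀ (by positivity)).1 (Nat.lt_floor_add_one _)
  exact step _ (hn ⌊t / (τ / 2)⌋₊) t h3 (by linarith)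

/-- A nonnegative function with a zero that satisfies a family of second order differential
inequalities expressing almost convexity of its logarithm vanishes identically. -/
theorem eq_zero_of_second_order (hk : 0 < k) (h1 : ∀ t, HasDerivAt N (N' t) t)
    (h2 : ∀ t, HasDerivAt N' (N'' t) t) (h0 : ∀ t, 0 ≤ N t)
    (hode : ∀ α t, -k * N t ≤ N'' t - 4 * α * N' t + 4 * α ^ 2 * N t) (hz : N 0 = 0)
    (t : ℝ) : N t = 0 := by
  rcases le_total 0 t with ht | ht
  · exact eq_zero_of_second_order_right hk h1 h2 h0 hode hz ht
  · have hneg : ∀ s : ℝ, HasDerivAt (fun s : ℝ => -s) (-1) s := fun s => (hasDerivAt_id s).neg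
    have h1' : ∀ s, HasDerivAt (fun s => N (-s)) (-N' (-s)) s := fun s =>
      ((h1 (-s)).comp s (hneg s)).congr_deriv (by ring)
    have h2' : ∀ s, HasDerivAt (fun s => -N' (-s)) (N'' (-s)) s := fun s =>
      ((h2 (-s)).comp s (hneg s)).neg.congr_deriv (by ring)
    -- Time reversal changes the sign of `N'`, and `α ↦ -α` restores the family of inequalities.
    have := eq_zero_of_second_order_right hk h1' h2' (fun s => h0 (-s))
      (fun α s => by have := hode (-α) (-s); linarith) (by simpa using hz) (neg_nonneg.2 ht)
    simpa using this

end Ode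

/-! ### The exponential weight. -/

section Weight

variable {W : Type*} [NormedAddCommGroup W]

/-- The weight `exp (-c √(1 + |x|^2))`. -/
noncomputable def expWeight (c : ℝ) (x : W) : ℝ := Real.exp (-c * Real.sqrt (1 + ‖x‖ ^ 2))

theorem expWeight_pos (c : ℝ) (x : W) : 0 < expWeight c x := Real.exp_pos _

theorem continuous_expWeight (c : ℝ) : Continuous (expWeight c : W → ℝ) := by
  unfold expWeight
  fun_prop

theorem expWeight_le {c : ℝ} (hc : 0 ≤ c) (x : W) : expWeight c x ≤ Real.exp (-c * ‖x‖) := by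
  refine Real.exp_le_exp.2 ?_
  have : ‖x‖ ≤ Real.sqrt (1 + ‖x‖ ^ 2) := Real.le_sqrt_of_sq_le (by linarith)
  nlinarith

variable [InnerProductSpace ℝ W]

/-- The logarithmic derivative of `expWeight`. -/
noncomputable def expWeightLog (c : ℝ) (v x : W) : ℝ :=
  -c * (inner ℝ x v / Real.sqrt (1 + ‖x‖ ^ 2))

theorem continuous_expWeightLog (c : ℝ) (v : W) : Continuous (expWeightLog c v) := by
  unfold expWeightLog
  have : ∀ x : W, Real.sqrt (1 + ‖x‖ ^ 2) ≠ 0 := fun x => (Real.sqrt_pos.2 (by positivity)).ne'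
  fun_prop (disch := assumption)

/-- This bound keeps the error term of the energy identity a bounded operator. -/
theorem abs_expWeightLog_le {c : ℝ} (hc : 0 ≤ c) (v x : W) :
    |expWeightLog c v x| ≤ c * ‖v‖ := by
  have h1 : 0 < Real.sqrt (1 + ‖x‖ ^ 2) := Real.sqrt_pos.2 (by positivity)
  have h2 : ‖x‖ ≤ Real.sqrt (1 + ‖x‖ ^ 2) := Real.le_sqrt_of_sq_le (by linarith)
  rw [expWeightLog, abs_mul, abs_neg, abs_of_nonneg hc, abs_div, abs_of_pos h1]
  refine mul_le_mul_of_nonneg_left ?_ hc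
  rw [div_le_iff₀ h1, mul_comm]
  exact (abs_real_inner_le_norm x v).trans (mul_le_mul_of_nonneg_right h2 (norm_nonneg _))

theorem hasFDerivAt_expWeight (c : ℝ) (x : W) :
    ∃ L : W →L[ℝ] ℝ, HasFDerivAt (expWeight c) L x ∧
      ∀ v, L v = expWeight c x * expWeightLog c v x := by
  have h1 : 0 < 1 + ‖x‖ ^ 2 := by positivity
  have h2 := ((((hasStrictFDerivAt_norm_sq x).hasFDerivAt.const_add 1).sqrt h1.ne').const_mul
    (-c)).exp
  refine ⟨_, h2, fun v => ?_⟩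
  simp only [expWeight, expWeightLog, smul_apply, innerSL_apply_apply, smul_eq_mul, nsmul_eq_mul]
  have h3 := (Real.sqrt_pos.2 h1).ne'
  field_simp
  simp

variable [FiniteDimensional ℝ W] [MeasurableSpace W] [BorelSpace W]

theorem integrable_exp_neg_norm : Integrable (fun x : W => Real.exp (-‖x‖)) volume := by
  set n := Module.finrank ℝ W + 1 with hn
  have h1 := integrable_one_add_norm (E := W) (μ := volume) (r := n) (by rw [hn]; push_cast; linarith)
  refine (h1.const_mul (Real.exp 1 * n.factorial)).mono' (by fun_prop)
    (Filter.Eventually.of_forall fun x => ?_)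
  -- One term of the exponential series gives `exp(-‖x‖) ≤ e n! (1 + ‖x‖)^(-n)`, integrable because
  -- `n` exceeds the dimension.
  have h2 := Real.pow_div_factorial_le_exp (x := 1 + ‖x‖) (by positivity) n
  rw [Real.norm_of_nonneg (Real.exp_pos _).le, Real.rpow_neg (by positivity), Real.rpow_natCast,
    Real.exp_neg]
  rw [Real.exp_add] at h2
  have h3 := Real.exp_pos ‖x‖
  have h4 : (0 : ℝ) < (1 + ‖x‖) ^ n := by positivity
  have h5 : (0 : ℝ) < n.factorial := by positivity
  rw [div_le_iff₀ h5] at h2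
  rw [inv_eq_one_div, div_le_iff₀ h3, mul_right_comm, ← div_eq_mul_inv, le_div_iff₀ h4]
  linarith

/-- A product of two functions of type `R` grows like `exp(2R‖x‖)`; the exponent `2R + 1` leaves
`exp(-‖x‖)` to spare. -/
theorem integrable_expWeight_mul {R : ℝ} (hR : 0 ≤ R) {f : W → ℝ} (hf : Continuous f) {K : ℝ}
    (hK : ∀ x, |f x| ≤ K * Real.exp (2 * R * ‖x‖)) :
    Integrable (fun x => expWeight (2 * R + 1) x * f x) volume := by
  refine (integrable_exp_neg_norm.const_mul K).mono'
    ((continuous_expWeight _).mul hf).aestronglyMeasurable (Filter.Eventually.of_forall fun x => ?_)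
  rw [norm_mul, Real.norm_of_nonneg (expWeight_pos _ _).le, Real.norm_eq_abs]
  calc expWeight (2 * R + 1) x * |f x|
      ≤ Real.exp (-(2 * R + 1) * ‖x‖) * (K * Real.exp (2 * R * ‖x‖)) :=
        mul_le_mul (expWeight_le (by positivity) x) (hK x) (abs_nonneg _) (Real.exp_pos _).le
    _ = K * Real.exp (-‖x‖) := by
        rw [mul_left_comm, ← Real.exp_add]
        congr 2
        ring

end Weight

/-! ### The weighted energy and its differential inequality. -/

section Energy

variable {W E : Type*} [NormedAddCommGroup W] [NormedAddCommGroup E] [InnerProductSpace ℝ E] {R : ℝ}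

/-- Time dependent functions of exponential growth. -/
structure ExpGrowth (R : ℝ) (a : ℝ → W → E) : Prop where
  cont : ∀ t, Continuous (a t)
  bound : ∃ C, 0 ≤ C ∧ ∀ t x, ‖a t x‖ ≤ C * Real.exp (R * (|t| + ‖x‖))

theorem ExpGrowth.inner_bound {a p : ℝ → W → E} (ha : ExpGrowth R a) (hp : ExpGrowth R p) :
    ∃ C, 0 ≤ C ∧ ∀ t x, |inner ℝ (a t x) (p t x)| ≤
      C * Real.exp (2 * R * |t|) * Real.exp (2 * R * ‖x‖) := by
  obtain ⟨C, hC, h1⟩ := ha.bound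
  obtain ⟨D, hD, h2⟩ := hp.bound
  refine ⟨C * D, mul_nonneg hC hD, fun t x => (abs_real_inner_le_norm _ _).trans
    ((mul_le_mul (h1 t x) (h2 t x) (norm_nonneg _) (by positivity)).trans (le_of_eq ?_))⟩
  rw [mul_mul_mul_comm, ← Real.exp_add, mul_assoc (C * D), ← Real.exp_add]
  congr 2
  ring

variable [InnerProductSpace ℝ W] [FiniteDimensional ℝ W] [MeasurableSpace W] [BorelSpace W]

theorem ExpGrowth.integrable_inner {a p : ℝ → W → E} (hR : 0 ≤ R) (ha : ExpGrowth R a)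
    (hp : ExpGrowth R p) (t : ℝ) :
    Integrable (fun x => expWeight (2 * R + 1) x * inner ℝ (a t x) (p t x)) volume := by
  obtain ⟨C, -, hC⟩ := ha.inner_bound hp
  exact integrable_expWeight_mul hR ((ha.cont t).inner (hp.cont t)) (hC t)

theorem ExpGrowth.hasDerivAt_integral_inner {a p a' p' : ℝ → W → E} (hR : 0 ≤ R)
    (ha : ExpGrowth R a) (hp : ExpGrowth R p) (ha' : ExpGrowth R a') (hp' : ExpGrowth R p')
    (hda : ∀ t x, HasDerivAt (fun t => a t x) (a' t x) t)
    (hdp : ∀ t x, HasDerivAt (fun t => p t x) (p' t x) t) (t : ℝ) :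
    HasDerivAt (fun t => ∫ x, expWeight (2 * R + 1) x * inner ℝ (a t x) (p t x))
      ((∫ x, expWeight (2 * R + 1) x * inner ℝ (a t x) (p' t x)) +
        ∫ x, expWeight (2 * R + 1) x * inner ℝ (a' t x) (p t x)) t := by
  obtain ⟨C, hC, h1⟩ := ha.inner_bound hp'
  obtain ⟨D, hD, h2⟩ := ha'.inner_bound hp
  rw [← integral_add (ha.integrable_inner hR hp' t) (ha'.integrable_inner hR hp t)]
  refine (hasDerivAt_integral_of_dominated_loc_of_deriv_le
    (F' := fun t x => expWeight (2 * R + 1) x * inner ℝ (a t x) (p' t x) +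
      expWeight (2 * R + 1) x * inner ℝ (a' t x) (p t x))
    (bound := fun x => expWeight (2 * R + 1) x * ((C + D) * Real.exp (2 * R * (|t| + 1)) *
      Real.exp (2 * R * ‖x‖)))
    (Metric.ball_mem_nhds t one_pos)
    (Filter.Eventually.of_forall fun s => (ha.integrable_inner hR hp s).aestronglyMeasurable)
    (ha.integrable_inner hR hp t)
    ((ha.integrable_inner hR hp' t).add (ha'.integrable_inner hR hp t)).aestronglyMeasurable
    (Filter.Eventually.of_forall fun x s hs => ?_)
    (integrable_expWeight_mul hR (by fun_prop)
      (K := (C + D) * Real.exp (2 * R * (|t| + 1))) fun x => ?_)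
    (Filter.Eventually.of_forall fun x s _ => ?_)).2
  · have hs' : |s| ≤ |t| + 1 := by
      have h3 : |s - t| < 1 := by simpa [Real.dist_eq] using hs
      have := abs_add_le t (s - t)
      rw [add_sub_cancel] at this
      linarith
    have h4 : Real.exp (2 * R * |s|) ≤ Real.exp (2 * R * (|t| + 1)) :=
      Real.exp_le_exp.2 (mul_le_mul_of_nonneg_left hs' (by positivity))
    rw [← mul_add, norm_mul, Real.norm_of_nonneg (expWeight_pos _ _).le, Real.norm_eq_abs]
    refine mul_le_mul_of_nonneg_left ?_ (expWeight_pos _ _).le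
    calc |inner ℝ (a s x) (p' s x) + inner ℝ (a' s x) (p s x)|
        ≤ (C + D) * Real.exp (2 * R * |s|) * Real.exp (2 * R * ‖x‖) := by
          have := abs_add_le (inner ℝ (a s x) (p' s x)) (inner ℝ (a' s x) (p s x))
          linarith [h1 s x, h2 s x]
      _ ≤ _ := mul_le_mul_of_nonneg_right (mul_le_mul_of_nonneg_left h4 (by positivity))
          (Real.exp_pos _).le
  · rw [abs_of_nonneg (by positivity)]
  · rw [← mul_add]
    exact ((hda s x).inner ℝ (hdp s x)).const_mul _

/-- Backward uniqueness from the energy identity `∫ w ⟨a, a''⟩ = ∫ w |a'|^2 - ∫ w ⟨b a, a'⟩`. -/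
theorem eq_zero_of_energy (hR : 0 ≤ R) {a p q : ℝ → W → E} (ha : ExpGrowth R a)
    (hp : ExpGrowth R p) (hq : ExpGrowth R q)
    (hda : ∀ t x, HasDerivAt (fun t => a t x) (p t x) t)
    (hdp : ∀ t x, HasDerivAt (fun t => p t x) (q t x) t)
    {b : W → E → E} {β : ℝ} (hβ : ∀ x u, ‖b x u‖ ≤ β * ‖u‖) (hb : ∀ x u, inner ℝ (b x u) u = 0)
    (hbg : ExpGrowth R fun t x => b x (a t x))
    (hid : ∀ t, ∫ x, expWeight (2 * R + 1) x * inner ℝ (a t x) (q t x) =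
      (∫ x, expWeight (2 * R + 1) x * inner ℝ (p t x) (p t x)) -
        ∫ x, expWeight (2 * R + 1) x * inner ℝ (b x (a t x)) (p t x))
    (h0 : ∀ x, a 0 x = 0) (t : ℝ) (x : W) : a t x = 0 := by
  set w : W → ℝ := expWeight (2 * R + 1) with hw
  set N : ℝ → ℝ := fun t => ∫ x, w x * inner ℝ (a t x) (a t x) with hN
  have iaa := ha.integrable_inner hR ha
  have iap := ha.integrable_inner hR hp
  have ipp := hp.integrable_inner hR hp
  have ibp := hbg.integrable_inner hR hp
  have h1 : ∀ t, HasDerivAt N (2 * ∫ x, w x * inner ℝ (a t x) (p t x)) t := fun t => by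
    refine (ha.hasDerivAt_integral_inner hR ha hp hp hda hda t).congr_deriv ?_
    simp only [real_inner_comm (a t _) (p t _)]
    exact (two_mul _).symm
  have h2 : ∀ t, HasDerivAt (fun t => 2 * ∫ x, w x * inner ℝ (a t x) (p t x))
      (4 * (∫ x, w x * inner ℝ (p t x) (p t x)) -
        2 * ∫ x, w x * inner ℝ (b x (a t x)) (p t x)) t := fun t => by
    refine ((ha.hasDerivAt_integral_inner hR hp hp hq hda hdp t).const_mul 2).congr_deriv ?_
    rw [hid]
    ring
  have hNnn : ∀ t, 0 ≤ N t := fun t => integral_nonneg fun x =>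
    mul_nonneg (expWeight_pos _ _).le real_inner_self_nonneg
  -- The summand `1` only makes the constant positive, so that a step length `τ` exists.
  have hode : ∀ α t, -(β ^ 2 + 1) * N t ≤ (4 * (∫ x, w x * inner ℝ (p t x) (p t x)) -
      2 * ∫ x, w x * inner ℝ (b x (a t x)) (p t x)) -
      4 * α * (2 * ∫ x, w x * inner ℝ (a t x) (p t x)) + 4 * α ^ 2 * N t := by
    intro α t
    have key : 0 ≤ ∫ x, ((4 * (w x * inner ℝ (p t x) (p t x)) -
        2 * (w x * inner ℝ (b x (a t x)) (p t x))) -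
        8 * α * (w x * inner ℝ (a t x) (p t x))) +
        (4 * α ^ 2 + (β ^ 2 + 1)) * (w x * inner ℝ (a t x) (a t x)) := by
      refine integral_nonneg fun x => ?_
      have hwx : 0 ≤ w x := (expWeight_pos _ _).le
      set u := a t x
      set v := p t x
      -- As `⟨bu, u⟩ = 0`, the integrand without its `β² + 1` term is `4|v - αu|² - 2⟨bu, v - αu⟩`,
      -- at least `-β²|u|²/4` on completing the square, whatever `α` is.
      have e1 : inner ℝ (b x u) v = inner ℝ (b x u) (v - α • u) := by
        rw [inner_sub_right, inner_smul_right, hb, mul_zero, sub_zero]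
      have e2 : inner ℝ (v - α • u) (v - α • u) =
          inner ℝ v v - 2 * α * inner ℝ u v + α ^ 2 * inner ℝ u u := by
        simp only [inner_sub_left, inner_sub_right, real_inner_smul_right, real_inner_comm]
        ring
      have e3 := (le_abs_self _).trans (abs_real_inner_le_norm (b x u) (v - α • u))
      have e4 := mul_le_mul_of_nonneg_right (hβ x u) (norm_nonneg (v - α • u))
      have e5 : inner ℝ (v - α • u) (v - α • u) = ‖v - α • u‖ ^ 2 := real_inner_self_eq_norm_sq _
      have e6 : inner ℝ u u = ‖u‖ ^ 2 := real_inner_self_eq_norm_sq _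
      have e7 : 0 ≤ 4 * inner ℝ v v - 2 * inner ℝ (b x u) v - 8 * α * inner ℝ u v +
          (4 * α ^ 2 + (β ^ 2 + 1)) * inner ℝ u u := by
        rw [e1]
        rw [e5] at e2
        rw [e6] at e2 ⊢
        nlinarith [sq_nonneg (2 * ‖v - α • u‖ - β * ‖u‖ / 2), sq_nonneg (β * ‖u‖), sq_nonneg ‖u‖]
      have e8 := mul_nonneg hwx e7
      simp only [Pi.zero_apply]
      linarith
    have i1 : Integrable (fun x => 4 * (w x * inner ℝ (p t x) (p t x)) -
        2 * (w x * inner ℝ (b x (a t x)) (p t x))) volume :=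
      ((ipp t).const_mul 4).sub ((ibp t).const_mul 2)
    have i2 : Integrable (fun x => 4 * (w x * inner ℝ (p t x) (p t x)) -
        2 * (w x * inner ℝ (b x (a t x)) (p t x)) -
        8 * α * (w x * inner ℝ (a t x) (p t x))) volume :=
      i1.sub ((iap t).const_mul (8 * α))
    rw [integral_add i2 ((iaa t).const_mul _), integral_sub i1 ((iap t).const_mul (8 * α)),
      integral_sub ((ipp t).const_mul 4) ((ibp t).const_mul 2),
      integral_const_mul, integral_const_mul, integral_const_mul, integral_const_mul] at key
    simp only [hN]
    linarith
  have hN0 : N 0 = 0 := by simp [hN, h0]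
  have hNt := eq_zero_of_second_order (by positivity) h1 h2 hNnn hode hN0 t
  have h3 := (integral_eq_zero_iff_of_nonneg (fun x =>
    mul_nonneg (expWeight_pos _ _).le real_inner_self_nonneg) (iaa t)).1 hNt
  have h4 := (Continuous.ae_eq_iff_eq volume ((continuous_expWeight _).mul
    ((ha.cont t).inner (ha.cont t))) continuous_zero).1 h3
  have h5 : expWeight (2 * R + 1) x * inner ℝ (a t x) (a t x) = 0 := congrFun h4 x
  exact inner_self_eq_zero.1 ((mul_eq_zero.1 h5).resolve_left (expWeight_pos _ _).ne')

end Energy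

/-! ### Mollification in space and uniqueness for first order systems. -/

section Mollify

variable {W E : Type*} [NormedAddCommGroup W] [NormedAddCommGroup E] {R : ℝ}

section Closure

variable {a p : ℝ → W → E}

theorem ExpGrowth.zero [InnerProductSpace ℝ E] : ExpGrowth R (fun (_ : ℝ) (_ : W) => (0 : E)) :=
  ⟨fun _ => continuous_const, 0, le_rfl, by simp⟩

theorem ExpGrowth.add [InnerProductSpace ℝ E] (ha : ExpGrowth R a) (hp : ExpGrowth R p) :
    ExpGrowth R fun t x => a t x + p t x := by
  obtain ⟨C, hC, h1⟩ := ha.bound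
  obtain ⟨D, hD, h2⟩ := hp.bound
  refine ⟨fun t => (ha.cont t).add (hp.cont t), C + D, add_nonneg hC hD, fun t x => ?_⟩
  rw [add_mul]
  exact (norm_add_le _ _).trans (add_le_add (h1 t x) (h2 t x))

theorem ExpGrowth.bdd_smul [InnerProductSpace ℝ E] (ha : ExpGrowth R a) {g : W → ℝ}
    (hg : Continuous g) {K : ℝ} (hK : ∀ x, |g x| ≤ K) : ExpGrowth R fun t x => g x • a t x := by
  obtain ⟨C, hC, h1⟩ := ha.bound
  refine ⟨fun t => hg.smul (ha.cont t), |K| * C, by positivity, fun t x => ?_⟩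
  rw [norm_smul, mul_assoc]
  exact mul_le_mul ((hK x).trans (le_abs_self K)) (h1 t x) (norm_nonneg _) (abs_nonneg _)

theorem ExpGrowth.clm [InnerProductSpace ℝ E] (ha : ExpGrowth R a) (J : E →L[ℝ] E) :
    ExpGrowth R fun t x => J (a t x) := by
  obtain ⟨C, hC, h1⟩ := ha.bound
  refine ⟨fun t => J.continuous.comp (ha.cont t), ‖J‖ * C, by positivity, fun t x => ?_⟩
  rw [mul_assoc]
  exact (J.le_opNorm _).trans (mul_le_mul_of_nonneg_left (h1 t x) (norm_nonneg _))

theorem ExpGrowth.neg [InnerProductSpace ℝ E] (ha : ExpGrowth R a) :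
    ExpGrowth R fun t x => -a t x := by
  obtain ⟨C, hC, h1⟩ := ha.bound
  exact ⟨fun t => (ha.cont t).neg, C, hC, fun t x => by rw [norm_neg]; exact h1 t x⟩

theorem ExpGrowth.sum [InnerProductSpace ℝ E] {ι : Type*} (s : Finset ι) {a : ι → ℝ → W → E}
    (ha : ∀ j ∈ s, ExpGrowth R (a j)) : ExpGrowth R fun t x => ∑ j ∈ s, a j t x := by
  classical
  induction s using Finset.induction_on with
  | empty => simpa using ExpGrowth.zero
  | insert j s hj ih =>
    simp only [Finset.sum_insert hj]
    exact (ha j (Finset.mem_insert_self j s)).add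
      (ih fun i hi => ha i (Finset.mem_insert_of_mem hi))

end Closure

variable [InnerProductSpace ℝ W] [FiniteDimensional ℝ W] [MeasurableSpace W] [BorelSpace W]
  [InnerProductSpace ℝ E]

/-- The regularization of `F t` by convolution with `φ`. -/
noncomputable def mollify (φ : W → ℝ) (F : ℝ → W → E) (t : ℝ) (x : W) : E :=
  ∫ z, φ z • F t (x - z)

variable {φ : W → ℝ} {F : ℝ → W → E}

theorem mollify_eq_convolution (φ : W → ℝ) (F : ℝ → W → E) (t : ℝ) :
    mollify φ F t = convolution φ (F t) (ContinuousLinearMap.lsmul ℝ ℝ) volume := rfl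

theorem ExpGrowth.mollify (hR : 0 ≤ R) (hF : ExpGrowth R F) (hφ : Continuous φ)
    (hc : HasCompactSupport φ) : ExpGrowth R (mollify φ F) := by
  refine ⟨fun t => ?_, ?_⟩
  · rw [mollify_eq_convolution]
    exact hc.continuous_convolution_left _ hφ (hF.cont t).locallyIntegrable
  · obtain ⟨C, hC, h1⟩ := hF.bound
    obtain ⟨ρ, hρ⟩ := hc.isBounded.subset_closedBall 0
    -- The support of `φ` lies in the ball of radius `ρ`, and a shift by at most `ρ` costs the
    -- factor `exp(Rρ)`.
    refine ⟨(∫ z, ‖φ z‖) * C * Real.exp (R * ρ), by positivity, fun t x => ?_⟩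
    have h2 : Integrable (fun z => ‖φ z‖ * (C * Real.exp (R * ρ) * Real.exp (R * (|t| + ‖x‖))))
        volume := (hφ.integrable_of_hasCompactSupport hc).norm.mul_const _
    refine (norm_integral_le_of_norm_le h2 (Filter.Eventually.of_forall fun z => ?_)).trans
      (le_of_eq ?_)
    · rw [norm_smul]
      by_cases hz : φ z = 0
      · simp [hz]
      · refine mul_le_mul_of_nonneg_left ((h1 t _).trans ?_) (norm_nonneg _)
        have h3 : ‖z‖ ≤ ρ := mem_closedBall_zero_iff.1 (hρ (subset_tsupport _ hz))
        have h4 : ‖x - z‖ ≤ ‖x‖ + ρ := (norm_sub_le x z).trans (by linarith)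
        rw [mul_assoc, ← Real.exp_add]
        refine mul_le_mul_of_nonneg_left (Real.exp_le_exp.2 ?_) hC
        rw [← mul_add]
        exact mul_le_mul_of_nonneg_left (by linarith) hR
    · rw [integral_mul_const]
      ring

theorem hasFDerivAt_mollify (hF : ∀ t, Continuous (F t)) (hφ : ContDiff ℝ 1 φ)
    (hc : HasCompactSupport φ) (t : ℝ) (x : W) :
    ∃ L : W →L[ℝ] E, HasFDerivAt (mollify φ F t) L x ∧
      ∀ v, L v = mollify (fun z => fderiv ℝ φ z v) F t x := by
  refine ⟨_, hc.hasFDerivAt_convolution_left (ContinuousLinearMap.lsmul ℝ ℝ) hφ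
    (hF t).locallyIntegrable x, fun v => ?_⟩
  have h1 : ConvolutionExistsAt (fderiv ℝ φ) (F t) x
      ((ContinuousLinearMap.lsmul ℝ ℝ (E := E)).precompL W) volume :=
    (hc.fderiv ℝ).convolutionExists_left _ (hφ.continuous_fderiv one_ne_zero)
      (hF t).locallyIntegrable x
  rw [convolution_def, ContinuousLinearMap.integral_apply h1]
  rfl

theorem hasDerivAt_mollify (hF : ContDiff ℝ 1 fun q : ℝ × W => F q.1 q.2) (hφ : Continuous φ)
    (hc : HasCompactSupport φ) (t : ℝ) (x : W) :
    HasDerivAt (fun t => mollify φ F t x)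
      (∫ z, φ z • fderiv ℝ (fun q : ℝ × W => F q.1 q.2) (t, x - z) (1, 0)) t := by
  set D := fderiv ℝ (fun q : ℝ × W => F q.1 q.2) with hD
  have hDc : Continuous D := hF.continuous_fderiv one_ne_zero
  have hFc : Continuous fun q : ℝ × W => F q.1 q.2 := hF.continuous
  have hDs : ∀ s, Continuous fun z => D (s, x - z) (1, 0) := fun s => by fun_prop
  have hFs : ∀ s, Continuous fun z => F s (x - z) := fun s =>
    hFc.comp (by fun_prop : Continuous fun z : W => (s, x - z))
  obtain ⟨K, hK⟩ := ((isCompact_closedBall t 1).prod hc.isCompact).exists_bound_of_continuousOn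
    (f := fun q : ℝ × W => D (q.1, x - q.2) (1, 0)) (by fun_prop)
  refine (hasDerivAt_integral_of_dominated_loc_of_deriv_le
    (F' := fun s z => φ z • D (s, x - z) (1, 0)) (bound := fun z => ‖φ z‖ * K)
    (Metric.ball_mem_nhds t one_pos)
    (Filter.Eventually.of_forall fun s => (hφ.smul (hFs s)).aestronglyMeasurable)
    ((hφ.smul (hFs t)).integrable_of_hasCompactSupport hc.smul_right)
    (hφ.smul (hDs t)).aestronglyMeasurable
    (Filter.Eventually.of_forall fun z s hs => ?_)
    ((hφ.integrable_of_hasCompactSupport hc).norm.mul_const _)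
    (Filter.Eventually.of_forall fun z s _ => ?_)).2
  · rw [norm_smul]
    by_cases hz : φ z = 0
    · simp [hz]
    · exact mul_le_mul_of_nonneg_left
        (hK (s, z) ⟨Metric.ball_subset_closedBall hs, subset_tsupport _ hz⟩) (norm_nonneg _)
  · have h1 : HasFDerivAt (fun q : ℝ × W => F q.1 q.2) (D (s, x - z)) (s, x - z) :=
      (hF.differentiable one_ne_zero _).hasFDerivAt
    have h2 : HasDerivAt (fun s : ℝ => (s, x - z)) ((1 : ℝ), (0 : W)) s :=
      (hasDerivAt_id s).prodMk (hasDerivAt_const s _)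
    exact (h1.comp_hasDerivAt s h2).const_smul (φ z)

/-- Integration by parts; its sign cancels against the one from differentiating `z ↦ F t (x - z)`.
-/
theorem integral_smul_fderiv_eq_mollify (hF : ContDiff ℝ 1 fun q : ℝ × W => F q.1 q.2)
    (hφ : ContDiff ℝ 1 φ) (hc : HasCompactSupport φ) (t : ℝ) (x v : W) :
    ∫ z, φ z • fderiv ℝ (fun q : ℝ × W => F q.1 q.2) (t, x - z) (0, v) =
      mollify (fun z => fderiv ℝ φ z v) F t x := by
  set D := fderiv ℝ (fun q : ℝ × W => F q.1 q.2) with hD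
  have hDc : Continuous D := hF.continuous_fderiv one_ne_zero
  have hFc : Continuous fun q : ℝ × W => F q.1 q.2 := hF.continuous
  have hDs : Continuous fun z => -D (t, x - z) (0, v) := by fun_prop
  have hFs : Continuous fun z => F t (x - z) :=
    hFc.comp (by fun_prop : Continuous fun z : W => (t, x - z))
  have hφ' : Continuous fun z => fderiv ℝ φ z v :=
    (hφ.continuous_fderiv one_ne_zero).clm_apply continuous_const
  have hc' : HasCompactSupport fun z => fderiv ℝ φ z v := hc.fderiv_apply ℝ v
  have h := integral_bilinear_hasLineDerivAt_right_eq_neg_left_of_integrable (μ := volume)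
    (f := φ) (f' := fun z => fderiv ℝ φ z v) (g := fun z => F t (x - z))
    (g' := fun z => -D (t, x - z) (0, v)) (v := v) (B := ContinuousLinearMap.lsmul ℝ ℝ)
    ((hφ'.smul hFs).integrable_of_hasCompactSupport hc'.smul_right)
    ((hφ.continuous.smul hDs).integrable_of_hasCompactSupport hc.smul_right)
    ((hφ.continuous.smul hFs).integrable_of_hasCompactSupport hc.smul_right)
    (fun z _ => (hφ.differentiable one_ne_zero z).hasFDerivAt.hasLineDerivAt v)
    (fun z _ => ?_)
  · simp only [ContinuousLinearMap.lsmul_apply, smul_neg, integral_neg, neg_inj] at h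
    exact h
  · have h1 : HasFDerivAt (fun q : ℝ × W => F q.1 q.2) (D (t, x - z)) (t, x - z) :=
      (hF.differentiable one_ne_zero _).hasFDerivAt
    have h2 : HasFDerivAt (fun z : W => (t, x - z)) ((0 : W →L[ℝ] ℝ).prod (-.id ℝ W)) z :=
      (hasFDerivAt_const t z).prodMk ((hasFDerivAt_id z).const_sub x)
    have h3 := (h1.comp z h2).hasLineDerivAt v
    have h4 : (D (t, x - z)) (0, -v) = -D (t, x - z) (0, v) := by
      rw [← map_neg, Prod.neg_mk, neg_zero]
    simp only [ContinuousLinearMap.comp_apply, ContinuousLinearMap.prod_apply, zero_apply,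
      neg_apply, ContinuousLinearMap.id_apply, h4] at h3
    exact h3

/-- Skewness of `L` and integration by parts each contribute a minus sign, so `L ∂_u` is symmetric
up to the term in which the derivative falls on the weight. -/
theorem integral_weight_skew (hR : 0 ≤ R) {L : E →L[ℝ] E}
    (hL : ∀ u u', inner ℝ (L u) u' = -inner ℝ u (L u')) {a a' p p' : ℝ → W → E}
    (ha : ExpGrowth R a) (ha' : ExpGrowth R a') (hp : ExpGrowth R p) (hp' : ExpGrowth R p')
    {u : W} (hda : ∀ t x, ∃ A : W →L[ℝ] E, HasFDerivAt (a t) A x ∧ A u = a' t x)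
    (hdp : ∀ t x, ∃ A : W →L[ℝ] E, HasFDerivAt (p t) A x ∧ A u = p' t x) (t : ℝ) :
    ∫ x, expWeight (2 * R + 1) x * inner ℝ (a t x) (L (p' t x)) =
      (∫ x, expWeight (2 * R + 1) x * inner ℝ (L (a' t x)) (p t x)) +
      ∫ x, expWeight (2 * R + 1) x *
        inner ℝ (expWeightLog (2 * R + 1) u x • L (a t x)) (p t x) := by
  set w : W → ℝ := expWeight (2 * R + 1)
  set g : W → ℝ := expWeightLog (2 * R + 1) u
  have hg : ExpGrowth R fun t x => g x • L (a t x) := (ha.clm L).bdd_smul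
    (continuous_expWeightLog _ u) (abs_expWeightLog_le (by positivity) u)
  have i1 := (ha'.clm L).integrable_inner hR hp t
  have i2 := hg.integrable_inner hR hp t
  have i3 := (ha.clm L).integrable_inner hR hp' t
  have i4 := (ha.clm L).integrable_inner hR hp t
  have e1 : ∀ x, (innerSL ℝ (w x • L (a' t x) + (w x * g x) • L (a t x))) (p t x) =
      w x * inner ℝ (L (a' t x)) (p t x) + w x * inner ℝ (g x • L (a t x)) (p t x) := fun x => by
    rw [innerSL_apply_apply, inner_add_left, real_inner_smul_left, real_inner_smul_left,
      real_inner_smul_left, mul_assoc]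
  have e2 : ∀ x, (innerSL ℝ (w x • L (a t x))) (p' t x) = w x * inner ℝ (L (a t x)) (p' t x) :=
    fun x => by rw [innerSL_apply_apply, real_inner_smul_left]
  have e3 : ∀ x, (innerSL ℝ (w x • L (a t x))) (p t x) = w x * inner ℝ (L (a t x)) (p t x) :=
    fun x => by rw [innerSL_apply_apply, real_inner_smul_left]
  have h := integral_bilinear_hasLineDerivAt_right_eq_neg_left_of_integrable (μ := volume)
    (f := fun x => w x • L (a t x))
    (f' := fun x => w x • L (a' t x) + (w x * g x) • L (a t x)) (g := p t) (g' := p' t) (v := u)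
    (B := innerSL ℝ) (by simp only [e1]; exact i1.add i2) (by simp only [e2]; exact i3)
    (by simp only [e3]; exact i4) (fun x _ => ?_) (fun x _ => ?_)
  · simp only [e1, e2] at h
    rw [integral_add i1 i2] at h
    simp only [hL (a t _), mul_neg, integral_neg, neg_inj] at h
    exact h
  · obtain ⟨A, hA, hAu⟩ := hda t x
    obtain ⟨B, hB, hBu⟩ := hasFDerivAt_expWeight (2 * R + 1) x
    have h3 := (hB.smul (L.hasFDerivAt.comp x hA)).hasLineDerivAt u
    simp [hAu, hBu] at h3
    exact h3
  · obtain ⟨A, hA, hAu⟩ := hdp t x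
    rw [← hAu]
    exact hA.hasLineDerivAt u

variable [CompleteSpace E] {ι : Type*} [Fintype ι] {J : ι → E →L[ℝ] E} {v : ι → W}

/-- Mollification of solutions of `∂_t F + ∑ j, J_j ∂_j F = 0`. -/
theorem hasDerivAt_mollify_of_system (hF : ContDiff ℝ 1 fun q : ℝ × W => F q.1 q.2)
    (hpde : ∀ q, fderiv ℝ (fun q : ℝ × W => F q.1 q.2) q (1, 0) +
      ∑ j, J j (fderiv ℝ (fun q : ℝ × W => F q.1 q.2) q (0, v j)) = 0)
    (hφ : ContDiff ℝ 1 φ) (hc : HasCompactSupport φ) (t : ℝ) (x : W) :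
    HasDerivAt (fun t => mollify φ F t x)
      (-∑ j, J j (mollify (fun z => fderiv ℝ φ z (v j)) F t x)) t := by
  refine (hasDerivAt_mollify hF hφ.continuous hc t x).congr_deriv ?_
  have hDc : Continuous (fderiv ℝ fun q : ℝ × W => F q.1 q.2) := hF.continuous_fderiv one_ne_zero
  have hi : ∀ j, Integrable (fun z => φ z • fderiv ℝ (fun q : ℝ × W => F q.1 q.2) (t, x - z)
      (0, v j)) volume := fun j =>
    (hφ.continuous.smul (by fun_prop)).integrable_of_hasCompactSupport hc.smul_right
  simp only [← integral_smul_fderiv_eq_mollify hF hφ hc, ← ContinuousLinearMap.integral_comp_comm _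
    (hi _)]
  rw [← integral_finsetSum _ fun j _ => (J j).integrable_comp (hi j), ← integral_neg]
  refine integral_congr_ae (Filter.Eventually.of_forall fun z => ?_)
  simp only [eq_neg_of_add_eq_zero_left (hpde (t, x - z)), map_smul, smul_neg, Finset.smul_sum]

/-- A solution of exponential growth of `∂_t F + ∑ j, J_j ∂_j F = 0` with skew-adjoint `J_j` that
vanishes at time zero vanishes identically. -/
theorem eq_zero_of_system (hR : 0 ≤ R) (hJ : ∀ j u u', inner ℝ (J j u) u' = -inner ℝ u (J j u'))
    (hF : ContDiff ℝ 1 fun q : ℝ × W => F q.1 q.2) (hFg : ExpGrowth R F)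
    (hpde : ∀ q, fderiv ℝ (fun q : ℝ × W => F q.1 q.2) q (1, 0) +
      ∑ j, J j (fderiv ℝ (fun q : ℝ × W => F q.1 q.2) q (0, v j)) = 0)
    (h0 : ∀ x, F 0 x = 0) (t : ℝ) (x : W) : F t x = 0 := by
  -- `F` is only `C^1`, but the energy needs two time derivatives. After mollification the system
  -- trades each time derivative for space derivatives, which fall on `φ`.
  have main : ∀ φ : W → ℝ, ContDiff ℝ (⊤ : ℕ∞) φ → HasCompactSupport φ →
      ∀ t x, mollify φ F t x = 0 := by
    intro φ hφ hc
    have hφ1 : ContDiff ℝ 1 φ := hφ.of_le (by exact_mod_cast le_top)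
    have hd1 : ∀ u, ContDiff ℝ (⊤ : ℕ∞) fun z => fderiv ℝ φ z u := fun u =>
      (hφ.fderiv_right (m := (⊤ : ℕ∞)) (by simp)).clm_apply contDiff_const
    have hd1' : ∀ u, ContDiff ℝ 1 fun z => fderiv ℝ φ z u := fun u =>
      (hd1 u).of_le (by exact_mod_cast le_top)
    have hd2 : ∀ u u', Continuous fun z => fderiv ℝ (fun z => fderiv ℝ φ z u) z u' := fun u u' =>
      ((hd1' u).continuous_fderiv one_ne_zero).clm_apply continuous_const
    have hc1 : ∀ u, HasCompactSupport fun z => fderiv ℝ φ z u := fun u => hc.fderiv_apply ℝ u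
    have hc2 : ∀ u u', HasCompactSupport fun z => fderiv ℝ (fun z => fderiv ℝ φ z u) z u' :=
      fun u u' => (hc1 u).fderiv_apply ℝ u'
    -- Differentiating `p` in time and applying the system to its space derivatives produce the
    -- mixed derivatives of `φ` in opposite orders.
    have hsymm : ∀ u u', (fun z => fderiv ℝ (fun z => fderiv ℝ φ z u) z u') =
        fun z => fderiv ℝ (fun z => fderiv ℝ φ z u') z u := by
      intro u u'
      funext z
      have hdd : DifferentiableAt ℝ (fderiv ℝ φ) z :=
        ((hφ.fderiv_right (m := (⊤ : ℕ∞)) (by simp)).differentiable (by simp)) z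
      have hs := ((contDiff_infty.1 hφ 2).contDiffAt (x := z)).isSymmSndFDerivAt (by simp)
      rw [fderiv_clm_apply hdd (differentiableAt_const u),
        fderiv_clm_apply hdd (differentiableAt_const u')]
      simpa using hs u' u
    have ga := hFg.mollify hR hφ.continuous hc
    have g1 : ∀ u, ExpGrowth R (mollify (fun z => fderiv ℝ φ z u) F) := fun u =>
      hFg.mollify hR (hd1 u).continuous (hc1 u)
    have g2 : ∀ u u', ExpGrowth R (mollify (fun z => fderiv ℝ (fun z => fderiv ℝ φ z u) z u') F) :=
      fun u u' => hFg.mollify hR (hd2 u u') (hc2 u u')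
    -- `p` and `q` are the first two time derivatives of the mollified solution, and `p' k` is the
    -- derivative of `p` along `v k`.
    set p : ℝ → W → E := fun t x => -∑ j, J j (mollify (fun z => fderiv ℝ φ z (v j)) F t x) with hp
    set p' : ι → ℝ → W → E := fun k t x => -∑ j, J j
      (mollify (fun z => fderiv ℝ (fun z => fderiv ℝ φ z (v j)) z (v k)) F t x) with hp'
    have gp : ExpGrowth R p := (ExpGrowth.sum _ fun j _ => (g1 (v j)).clm (J j)).neg
    have gp' : ∀ k, ExpGrowth R (p' k) := fun k =>
      (ExpGrowth.sum _ fun j _ => (g2 (v j) (v k)).clm (J j)).neg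
    set q : ℝ → W → E := fun t x => -∑ k, J k (p' k t x) with hq
    have gq : ExpGrowth R q := (ExpGrowth.sum _ fun k _ => (gp' k).clm (J k)).neg
    have hda := hasDerivAt_mollify_of_system hF hpde hφ1 hc
    have hdp : ∀ t x, HasDerivAt (fun t => p t x) (q t x) t := by
      intro t x
      have h1 := (HasDerivAt.fun_sum (u := Finset.univ) fun j _ =>
        (J j).hasFDerivAt.comp_hasDerivAt t
          (hasDerivAt_mollify_of_system hF hpde (hd1' (v j)) (hc1 (v j)) t x)).neg
      refine h1.congr_deriv ?_
      simp only [hq, hp']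
      congr 1
      refine Finset.sum_congr rfl fun j _ => ?_
      congr 2
      refine Finset.sum_congr rfl fun k _ => ?_
      rw [hsymm]
    have hxa : ∀ j t x, ∃ A : W →L[ℝ] E, HasFDerivAt (mollify φ F t) A x ∧
        A (v j) = mollify (fun z => fderiv ℝ φ z (v j)) F t x := fun j t x => by
      obtain ⟨L, hL, hLv⟩ := hasFDerivAt_mollify hFg.cont hφ1 hc t x
      exact ⟨L, hL, hLv _⟩
    have hxp : ∀ k t x, ∃ A : W →L[ℝ] E, HasFDerivAt (p t) A x ∧ A (v k) = p' k t x := by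
      intro k t x
      choose L hL hLv using fun j =>
        hasFDerivAt_mollify (F := F) hFg.cont (hd1' (v j)) (hc1 (v j)) t x
      refine ⟨_, (HasFDerivAt.fun_sum (u := Finset.univ) fun j _ =>
        (J j).hasFDerivAt.comp x (hL j)).neg, ?_⟩
      simp [hp', hLv]
    set b : W → E → E := fun x u => ∑ j, expWeightLog (2 * R + 1) (v j) x • J j u with hb
    have gbj : ∀ j, ExpGrowth R fun t x =>
        expWeightLog (2 * R + 1) (v j) x • J j (mollify φ F t x) := fun j =>
      (ga.clm (J j)).bdd_smul (continuous_expWeightLog _ _)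
        (abs_expWeightLog_le (by positivity) _)
    refine eq_zero_of_energy hR ga gp gq hda hdp (b := b)
      (β := ∑ j, (2 * R + 1) * ‖v j‖ * ‖J j‖) ?_ ?_ (ExpGrowth.sum _ fun j _ => gbj j) ?_ ?_
    · intro x u
      rw [Finset.sum_mul]
      refine (norm_sum_le _ _).trans (Finset.sum_le_sum fun j _ => ?_)
      rw [norm_smul, mul_assoc]
      exact mul_le_mul (abs_expWeightLog_le (by positivity) _ _) ((J j).le_opNorm u)
        (norm_nonneg _) (by positivity)
    · intro x u
      rw [hb, sum_inner]
      refine Finset.sum_eq_zero fun j _ => ?_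
      have := hJ j u u
      rw [real_inner_comm] at this
      rw [real_inner_smul_left, real_inner_comm, show inner ℝ u (J j u) = 0 by linarith, mul_zero]
    · intro t
      have hj := fun j => integral_weight_skew hR (hJ j) ga (g1 (v j)) gp (gp' j) (hxa j) (hxp j) t
      have e1 : ∀ x, expWeight (2 * R + 1) x * inner ℝ (mollify φ F t x) (q t x) =
          -∑ j, expWeight (2 * R + 1) x * inner ℝ (mollify φ F t x) (J j (p' j t x)) := fun x => by
        simp only [hq, inner_neg_right, inner_sum, Finset.mul_sum, mul_neg]
      have e2 : ∀ x, expWeight (2 * R + 1) x * inner ℝ (p t x) (p t x) =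
          -∑ j, expWeight (2 * R + 1) x *
            inner ℝ (J j (mollify (fun z => fderiv ℝ φ z (v j)) F t x)) (p t x) := fun x => by
        -- Only the left factor is expanded; the right one must remain `p` to match
        -- `integral_weight_skew`.
        conv_lhs => enter [2, 2]; rw [hp]
        simp only [inner_neg_left, sum_inner, Finset.mul_sum, mul_neg]
      have e3 : ∀ x, expWeight (2 * R + 1) x * inner ℝ (b x (mollify φ F t x)) (p t x) =
          ∑ j, expWeight (2 * R + 1) x * inner ℝ (expWeightLog (2 * R + 1) (v j) x •
            J j (mollify φ F t x)) (p t x) := fun x => by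
        simp only [hb, sum_inner, Finset.mul_sum]
      simp only [e1, e2, e3, integral_neg]
      rw [integral_finsetSum _ fun j _ => ga.integrable_inner hR ((gp' j).clm (J j)) t,
        integral_finsetSum _ fun j _ => ((g1 (v j)).clm (J j)).integrable_inner hR gp t,
        integral_finsetSum _ fun j _ => (gbj j).integrable_inner hR gp t]
      simp only [hj, Finset.sum_add_distrib]
      ring
    · intro x
      simp [mollify, h0]
  -- For fixed `t` and `x` the mollifications are the pairings of `z ↦ F t (x - z)` with all test
  -- functions; hence this function vanishes, in particular at `z = 0`.
  have hcont : Continuous fun z => F t (x - z) := (hFg.cont t).comp (by fun_prop)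
  have h1 := ae_eq_zero_of_integral_contDiff_smul_eq_zero (μ := volume)
    hcont.locallyIntegrable fun φ hφ hc => main φ hφ hc t x
  have h2 := (Continuous.ae_eq_iff_eq volume hcont continuous_zero).1 h1
  simpa using congrFun h2 0

end Mollify

/-! ### Uniqueness of the monogenic extension. -/

namespace CliffordPW

variable {m : ℕ} {R : ℝ}

/-- The linear equivalence `(s, v) ↦ s + v` as a continuous linear map. -/
noncomputable def paraCLM (m : ℕ) : ℝ × V m →L[ℝ] X m :=
  (WithLp.prodContinuousLinearEquiv 2 ℝ ℝ (V m)).symm.toContinuousLinearMap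

theorem paraCLM_apply (q : ℝ × V m) : paraCLM m q = para q.1 q.2 := rfl

theorem norm_para_le (s : ℝ) (v : V m) : ‖para s v‖ ≤ |s| + ‖v‖ := by
  have h : para s v = para s 0 + para 0 v := by
    rw [← paraCLM_apply (s, v), ← paraCLM_apply (s, 0), ← paraCLM_apply (0, v), ← map_add]
    simp
  rw [h]
  refine (norm_add_le _ _).trans (le_of_eq ?_)
  simp [para]

/-- Left multiplication by a generator as a real-linear map. -/
noncomputable def genCLM (j : Fin m) : Cl m →L[ℝ] Cl m := (mulCLM m (gen j)).restrictScalars ℝ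

theorem IsLeftMonogenic.sub {F₁ F₂ : X m → Cl m} (h₁ : IsLeftMonogenic F₁)
    (h₂ : IsLeftMonogenic F₂) : IsLeftMonogenic (fun x => F₁ x - F₂ x) := by
  simpa [sub_eq_add_neg] using h₁.add (h₂.const_smul (-1))

/-- A left-monogenic function of exponential growth that vanishes on `R^m` vanishes. -/
theorem IsLeftMonogenic.eq_zero (hR : 0 ≤ R) {F : X m → Cl m} (hF : IsLeftMonogenic F)
    (hb : ∃ C : ℝ, ∀ x, ‖F x‖ ≤ C * Real.exp (R * ‖x‖)) (h0 : ∀ y : V m, F (para 0 y) = 0) :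
    F = 0 := by
  have hc : (fun q : ℝ × V m => F (para q.1 q.2)) = F ∘ paraCLM m := rfl
  have hcd : ContDiff ℝ 1 fun q : ℝ × V m => F (para q.1 q.2) := by
    rw [hc]
    exact hF.1.comp (paraCLM m).contDiff
  have hfd : ∀ q u, fderiv ℝ (fun q : ℝ × V m => F (para q.1 q.2)) q u =
      fderiv ℝ F (paraCLM m q) (paraCLM m u) := fun q u => by
    rw [hc, fderiv_comp q (hF.1.differentiable one_ne_zero _) (paraCLM m).differentiableAt]
    simp
  have hg : ExpGrowth R fun s v => F (para s v) := by
    obtain ⟨C, hC⟩ := hb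
    refine ⟨fun s => hcd.continuous.comp (by fun_prop : Continuous fun v : V m => (s, v)), |C|,
      abs_nonneg C, fun s v => (hC _).trans ?_⟩
    exact mul_le_mul (le_abs_self C) (Real.exp_le_exp.2
      (mul_le_mul_of_nonneg_left (norm_para_le s v) hR)) (Real.exp_pos _).le (abs_nonneg C)
  -- For the real part of the Hermitian product the generators are still skew, and the Dirac
  -- equation is the system with `x_0` as time.
  let : InnerProductSpace ℝ (Cl m) := InnerProductSpace.complexToReal
  have h := eq_zero_of_system (F := fun s v => F (para s v)) (J := genCLM)
    (v := fun j : Fin m => EuclideanSpace.single j (1 : ℝ)) hR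
    (fun j a b => by
      have := congrArg Complex.re (inner_gen_mul_left j a b)
      rwa [Complex.neg_re] at this)
    hcd hg (fun q => by
      simp only [hfd]
      exact hF.2 (paraCLM m q)) h0
  funext x
  exact h x.fst x.snd

/-- The left-monogenic extension is unique. -/
theorem IsExtension.unique (hR : 0 ≤ R) {f : L2 m} {F₁ F₂ : X m → Cl m}
    (h₁ : IsExtension R f F₁) (h₂ : IsExtension R f F₂) : F₁ = F₂ := by
  have hcont : ∀ {F : X m → Cl m}, IsExtension R f F → Continuous fun y : V m => F (para 0 y) :=
    fun h => h.monogenic.1.continuous.comp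
      ((paraCLM m).continuous.comp (by fun_prop : Continuous fun y : V m => ((0 : ℝ), y)))
  have he := (Continuous.ae_eq_iff_eq volume (hcont h₁) (hcont h₂)).1
    (h₁.restrict.trans h₂.restrict.symm)
  have h := (h₁.monogenic.sub h₂.monogenic).eq_zero hR ?_ fun y => sub_eq_zero.2 (congrFun he y)
  · funext x
    exact sub_eq_zero.1 (congrFun h x)
  · obtain ⟨C, hC⟩ := h₁.bound
    obtain ⟨D, hD⟩ := h₂.bound
    refine ⟨C + D, fun x => (norm_sub_le _ _).trans ?_⟩
    rw [add_mul]
    exact add_le_add (hC x) (hD x)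

/-! ### The reproducing kernel -/

theorem conj_eFun (x : X m) (ξ : V m) : conj (eFun x ξ) = eFun (para x.fst (-x.snd)) ξ := by
  rw [eFun, eFun, conj_add, ePlus, eMinus, ePlus, eMinus, conj_smul, conj_smul, conj_chiPlus,
    conj_chiMinus, para_fst, para_snd, inner_neg_left]
  simp only [map_mul, ← Complex.exp_conj, Complex.conj_I, Complex.conj_ofReal, map_neg, neg_mul,
    Complex.ofReal_neg, mul_neg]

/-- The mixed terms vanish because `χ_+ χ_- = χ_- χ_+ = 0`, and on the range of each idempotent `e`
is a scalar exponential. -/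
theorem eFun_add {ξ : V m} (hξ : ξ ≠ 0) (w z : X m) : eFun (w + z) ξ = eFun w ξ * eFun z ξ := by
  simp only [eFun, ePlus_eq, eMinus_eq, map_add, Complex.exp_add, add_mul, mul_add,
    smul_mul_smul_comm, chiPlus_mul_self hξ, chiMinus_mul_self hξ, chiPlus_mul_chiMinus hξ,
    chiMinus_mul_chiPlus hξ, smul_zero, add_zero, zero_add]

theorem integrable_indicator_eFun (x : X m) :
    Integrable (fun ξ => (Metric.ball 0 R).indicator (eFun x) ξ) volume := by
  rw [integrable_indicator_iff measurableSet_ball]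
  refine Measure.integrableOn_of_bounded (M := 2 * ‖(1 : Cl m)‖ * Real.exp (R * ‖x‖))
    measure_ball_lt_top.ne (stronglyMeasurable_eFun x).aestronglyMeasurable ?_
  exact ae_mem_ball.mono fun _ h => norm_eFun_le_of_le h

theorem memLp_indicator_eFun (x : X m) :
    MemLp ((Metric.ball 0 R).indicator (eFun x)) 2 volume := by
  rw [memLp_indicator_iff_restrict measurableSet_ball]
  have : IsFiniteMeasure (volume.restrict (Metric.ball (0 : V m) R)) :=
    ⟨by rw [Measure.restrict_apply_univ]; exact measure_ball_lt_top⟩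
  exact MemLp.of_bound (stronglyMeasurable_eFun x).aestronglyMeasurable
    (2 * ‖(1 : Cl m)‖ * Real.exp (R * ‖x‖)) (ae_mem_ball.mono fun _ h => norm_eFun_le_of_le h)

theorem exists_kernel_element (R : ℝ) (x : X m) :
    ∃ p : PW m R, fourierL2 (p : L2 m) =ᵐ[volume]
      (Metric.ball 0 R).indicator (eFun (paraConj x)) := by
  obtain ⟨p, hp⟩ := exists_fourierL2_eq (memLp_indicator_eFun (R := R) (paraConj x))
  refine ⟨⟨p, ?_⟩, hp⟩
  change ∀ᵐ ξ : V m, _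
  filter_upwards [hp] with ξ hξ h
  rw [hξ, Set.indicator_of_notMem fun h' => h (Metric.ball_subset_closedBall h')]

/-- The element `P(·, conj x)` of the Paley–Wiener space. -/
noncomputable def kernelElement (R : ℝ) (x : X m) : PW m R := (exists_kernel_element R x).choose

theorem fourierL2_kernelElement (R : ℝ) (x : X m) :
    fourierL2 (kernelElement R x : L2 m) =ᵐ[volume]
      (Metric.ball 0 R).indicator (eFun (paraConj x)) := (exists_kernel_element R x).choose_spec

theorem pwExt_congr {G G' : V m → Cl m} (h : G =ᵐ[volume] G') (x : X m) :
    pwExt R G x = pwExt R G' x := by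
  rw [pwExt, pwExt]
  congr 1
  refine integral_congr_ae ?_
  filter_upwards [h] with ξ hξ
  simp only [Set.indicator, hξ]

theorem pwExt_kernelElement (hm : 0 < m) (x w : X m) :
    pwExt R (fourierL2 (kernelElement R x : L2 m)) w = pwKernel R w (paraConj x) := by
  have : Nonempty (Fin m) := ⟨⟨0, hm⟩⟩
  rw [pwExt_congr (fourierL2_kernelElement R x), pwExt, pwKernel]
  congr 1
  refine integral_congr_ae ?_
  -- The idempotent relations require `ξ ≠ 0`; the origin is a null set because `m > 0`.
  filter_upwards [Measure.ae_ne volume (0 : V m)] with ξ hξ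
  by_cases h : ξ ∈ Metric.ball (0 : V m) R
  · simp only [Set.indicator_of_mem h, eFun_add hξ]
  · simp only [Set.indicator_of_notMem h]

/-- The reproducing property: in Plancherel's formula the conjugate of `e(x̄, ξ)` is `e(x, ξ)`,
which is the integrand of the extension at `x`. -/
theorem cInner_kernelElement (f : L2 m) (x : X m) :
    cInner f (kernelElement R x) = pwExt R (fourierL2 f) x := by
  rw [cInner_eq_integral_fourierL2 (integrable_fourierL2 (kernelElement R x).2), pwExt]
  congr 1
  refine integral_congr_ae ?_
  filter_upwards [fourierL2_kernelElement R x] with ξ hξ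
  rw [hξ]
  by_cases h : ξ ∈ Metric.ball (0 : V m) R
  · simp only [Set.indicator_of_mem h, paraConj, conj_eFun, para_fst, para_snd, neg_neg]
    rfl
  · have h0 : conj (0 : Cl m) = 0 := (conjCLM m).map_zero
    simp only [Set.indicator_of_notMem h, h0, zero_mul]

/-- Hermitian symmetry of the kernel, which identifies the integral against `P(x, ȳ)` with the
Clifford inner product. -/
theorem conj_pwKernel (y : V m) (x : X m) :
    conj (pwKernel R (para 0 y) (paraConj x)) = pwKernel R x (paraConj (para 0 y)) := by
  rw [pwKernel, pwKernel, conj_real_smul, ← conjCLM_apply,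
    ← (conjCLM m).integral_comp_comm (integrable_indicator_eFun _)]
  congr 1
  refine integral_congr_ae (Filter.Eventually.of_forall fun ξ => ?_)
  by_cases h : ξ ∈ Metric.ball (0 : V m) R
  · simp only [Set.indicator_of_mem h, conjCLM_apply, conj_eFun]
    congr 1
    apply (WithLp.equiv 2 _).injective
    ext1
    · simp [para, paraConj, add_comm]
    · simp [para, paraConj, add_comm]
  · simp only [Set.indicator_of_notMem h, map_zero]

theorem integral_pwKernel_mul (hm : 0 < m) (hR : 0 < R) (f : L2 m) (x : X m) :
    ∫ y : V m, pwKernel R x (paraConj (para 0 y)) * f y = cInner f (kernelElement R x) := by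
  refine integral_congr_ae ?_
  filter_upwards [pwExt_para_zero_ae hR (kernelElement R x).2] with y hy
  rw [← hy, pwExt_kernelElement hm, conj_pwKernel]

theorem pwExt_rmul {f : L2 m} (hf : Integrable (fourierL2 f) volume) (a : Cl m) (x : X m) :
    pwExt R (fourierL2 (rmul f a)) x = pwExt R (fourierL2 f) x * a := by
  rw [pwExt_congr (fourierL2_rmul hf a), pwExt, pwExt, integral_indicator measurableSet_ball,
    integral_indicator measurableSet_ball, ← Complex.coe_smul, ← Complex.coe_smul, smul_mul_assoc,
    ← integral_mul_right_cl (integrable_eFun_mul hf x)]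
  simp only [mul_assoc]

/-- The right multiplication by `a` on the Paley–Wiener space. -/
noncomputable def rmulPW (f : PW m R) (a : Cl m) : PW m R := ⟨rmul f a, rmul_mem f.2 a⟩

/-- The adjoint of evaluation at `x` is `a ↦ P(·, x̄) a`. Linearity and boundedness of evaluation
and the form of the operator-valued kernel are read off from this. -/
theorem inner_rmulPW_kernelElement (f : PW m R) (x : X m) (a : Cl m) :
    inner ℂ (rmulPW (kernelElement R x) a) f = inner ℂ a (pwExt R (fourierL2 (f : L2 m)) x) := by
  change inner ℂ (rmul (kernelElement R x) a) (f : L2 m) = _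
  rw [← Sc_cInner, cInner_rmul_right, cInner_kernelElement, Sc_conj_mul]

theorem norm_rmul_le (f : L2 m) (a : Cl m) : ‖rmul f a‖ ≤ ‖mulCLM m‖ * ‖a‖ * ‖f‖ := by
  refine (ContinuousLinearMap.norm_compLp_le _ f).trans
    (mul_le_mul_of_nonneg_right ?_ (norm_nonneg f))
  refine ContinuousLinearMap.opNorm_le_bound _ (by positivity) fun b => ?_
  exact (norm_mul_le_mulCLM b a).trans (le_of_eq (by ring))

/-- Point evaluations as continuous linear maps. -/
noncomputable def evalCLM (R : ℝ) (x : X m) : PW m R →L[ℂ] Cl m :=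
  LinearMap.mkContinuousOfExistsBound
    { toFun := fun f => pwExt R (fourierL2 (f : L2 m)) x
      map_add' := fun f g => by
        refine ext_inner_left ℂ fun a => ?_
        rw [← inner_rmulPW_kernelElement, inner_add_right, inner_add_right,
          inner_rmulPW_kernelElement, inner_rmulPW_kernelElement]
      map_smul' := fun c f => by
        refine ext_inner_left ℂ fun a => ?_
        rw [← inner_rmulPW_kernelElement, inner_smul_right, RingHom.id_apply, inner_smul_right,
          inner_rmulPW_kernelElement] }
    (by
      refine ⟨‖mulCLM m‖ * ‖kernelElement R x‖, fun f => ?_⟩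
      rw [LinearMap.coe_mk, AddHom.coe_mk]
      -- Testing against the value `a = f(x)` itself, Cauchy–Schwarz gives `|a|² ≤ ‖P(·, x̄) a‖
      -- ‖f‖`, and one factor `|a|` cancels.
      set a := pwExt R (fourierL2 (f : L2 m)) x with ha
      rcases (norm_nonneg a).eq_or_lt with h | h
      · rw [← h]
        positivity
      · have h1 := (norm_inner_le_norm (𝕜 := ℂ) (rmulPW (kernelElement R x) a) f)
        rw [inner_rmulPW_kernelElement, ← ha, inner_self_eq_norm_sq_to_K, norm_pow,
          RCLike.norm_ofReal, abs_norm] at h1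
        have h2 := mul_le_mul_of_nonneg_right (norm_rmul_le (kernelElement R x : L2 m) a)
          (norm_nonneg f)
        have h3 : ‖a‖ * ‖a‖ ≤ (‖mulCLM m‖ * ‖kernelElement R x‖ * ‖f‖) * ‖a‖ := by
          rw [← sq]
          exact (h1.trans h2).trans (le_of_eq (by simp only [Submodule.coe_norm]; ring))
        exact le_of_mul_le_mul_right h3 h)

theorem pwExt_injective (hR : 0 < R) {f g : PW m R}
    (h : pwExt R (fourierL2 (f : L2 m)) = pwExt R (fourierL2 (g : L2 m))) : f = g := by
  refine Subtype.ext (Lp.ext ?_)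
  filter_upwards [pwExt_para_zero_ae hR f.2, pwExt_para_zero_ae hR g.2] with y h1 h2
  rw [← h1, ← h2, h]

/-- The Paley–Wiener space as a reproducing kernel Hilbert space of functions on `R^(m+1)`. -/
noncomputable abbrev rkhsPW (hR : 0 < R) : RKHS ℂ (PW m R) (X m) (Cl m) where
  coeCLM := ContinuousLinearMap.pi (evalCLM R)
  coeCLM_injective := fun _ _ h => pwExt_injective hR h

theorem rkhsPW_kernel_apply (hm : 0 < m) (hR : 0 < R) (w x : X m) (v : Cl m) :
    letI := rkhsPW (m := m) hR
    RKHS.kernel (PW m R) w x v = pwKernel R w (paraConj x) * v := by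
  let _ := rkhsPW (m := m) hR
  have h1 : RKHS.kerFun (PW m R) x v = rmulPW (kernelElement R x) v := by
    refine ext_inner_right ℂ fun f => ?_
    rw [inner_rmulPW_kernelElement, RKHS.kerFun_inner]
    rfl
  rw [← RKHS.kerFun_apply, h1]
  change pwExt R (fourierL2 (rmul (kernelElement R x) v)) w = _
  rw [pwExt_rmul (integrable_fourierL2 (kernelElement R x).2), pwExt_kernelElement hm]

end CliffordPW

/-! ### Assembly of the theorem. -/

theorem mainTheorem6 (m : ℕ) (hm : 0 < m) (h : ℝ) (hh : 0 < h) :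
    -- `PW(π/h, C^(m))` is a right Clifford module with a Clifford-valued inner product
    (∀ f ∈ PW m (Real.pi / h), ∀ a : Cl m, rmul f a ∈ PW m (Real.pi / h)) ∧
    (∀ f ∈ PW m (Real.pi / h), ∀ g ∈ PW m (Real.pi / h),
      Integrable (fun y => conj (g y) * f y) volume ∧
      cInner g f = conj (cInner f g) ∧
      (∀ k ∈ PW m (Real.pi / h), ∀ a : Cl m, cInner (rmul f a + k) g = cInner f g * a + cInner k g) ∧
      inner ℂ g f = Sc (cInner f g)) ∧
    (∀ f ∈ PW m (Real.pi / h), ((‖f‖ ^ 2 : ℝ) : ℂ) = Sc (cInner f f)) ∧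
    -- the integral that defines the kernel converges
    (∀ w z : X m, Integrable (fun ξ => (Metric.ball 0 (Real.pi / h)).indicator (eFun (w + z)) ξ) volume) ∧
    -- it is complete, and its elements are functions on `R^(m+1)` with continuous evaluations
    ∃ (_ : CompleteSpace (PW m (Real.pi / h)))
      (_ : RKHS ℂ (PW m (Real.pi / h)) (X m) (Cl m))
      (p : X m → PW m (Real.pi / h)),
      -- the value `f(x)` is that of the unique left-monogenic extension of `f`
      (∀ f : PW m (Real.pi / h), IsExtension (Real.pi / h) f (RKHS.coeCLM ℂ f) ∧
        ∀ F : X m → Cl m, IsExtension (Real.pi / h) f F → F = RKHS.coeCLM ℂ f) ∧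
      -- `p x` is `P(·, conj x)`
      (∀ x w : X m, RKHS.coeCLM ℂ (p x) w = pwKernel (Real.pi / h) w (paraConj x)) ∧
      -- the reproducing property
      (∀ (f : PW m (Real.pi / h)) (x : X m),
        cInner f (p x) = RKHS.coeCLM ℂ f x ∧
        (∫ y : V m, pwKernel (Real.pi / h) x (paraConj (para 0 y)) * (f : L2 m) y) = RKHS.coeCLM ℂ f x ∧
        (((2 * Real.pi) ^ m)⁻¹ : ℝ) • (∫ ξ : V m, (Metric.ball 0 (Real.pi / h)).indicator
          (fun ξ => eFun x ξ * fourierL2 (f : L2 m) ξ) ξ) = RKHS.coeCLM ℂ f x) ∧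
      -- `P(·, conj x)` is the only kernel with this property
      (∀ (x : X m) (q : PW m (Real.pi / h)),
        (∀ f : PW m (Real.pi / h), cInner f q = RKHS.coeCLM ℂ f x) → q = p x) ∧
      -- and the operator-valued kernel is left multiplication by `P(w, conj x)`
      (∀ (w x : X m) (v : Cl m),
        RKHS.kernel (PW m (Real.pi / h)) w x v = pwKernel (Real.pi / h) w (paraConj x) * v) := by
  have hR : 0 < Real.pi / h := div_pos Real.pi_pos hh
  refine ⟨fun f hf a => rmul_mem hf a, fun f _ g _ => ⟨integrable_conj_mul (Lp.memLp g) (Lp.memLp f),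
    (conj_cInner f g).symm, fun k _ a => ?_, (Sc_cInner f g).symm⟩, fun f _ => ?_,
    fun w z => integrable_indicator_eFun (w + z), inferInstance, rkhsPW hR,
    kernelElement (Real.pi / h), fun f => ⟨isExtension_pwExt hR f.2, fun F hF =>
      hF.unique hR.le (isExtension_pwExt hR f.2)⟩, fun x w => pwExt_kernelElement hm x w,
    fun f x => ⟨cInner_kernelElement f x, ?_, rfl⟩, fun x q hq => ?_,
    fun w x v => rkhsPW_kernel_apply hm hR w x v⟩
  · rw [cInner_add_left, cInner_rmul_left]
  · rw [Sc_cInner, inner_self_eq_norm_sq_to_K]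
    push_cast
    rfl
  · rw [integral_pwKernel_mul hm hR, cInner_kernelElement]
    rfl
  -- Scalar parts of the Clifford inner product are Hilbert inner products, so two kernels with the
  -- same pairings coincide.
  · refine ext_inner_right ℂ fun f => ?_
    change inner ℂ (q : L2 m) (f : L2 m) = inner ℂ (kernelElement _ x : L2 m) (f : L2 m)
    rw [← Sc_cInner, ← Sc_cInner, hq, cInner_kernelElement]
    rfl
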